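/- Let $\mathcal H$ be a finite $k$-uniform hypergraph ($k$-graph) with vertex set $V(\mathcal H)$ and edge set $E(\mathcal H)$. Write $d_{\mathcal H}(x)$ for the number of edges containing $x$ and $\delta$ for the minimum degree. Let $\mathcal H\setminus\{z\}$ denote $\mathcal H$ with the vertex $z$ and all edges containing it deleted, and, for edges $e,e'$, let $\mathcal H\setminus\{e,e'\}$ denote the $k$-graph formed by the remaining edges and the vertices they cover. A monomorphism is an injective map between vertex sets that maps edges to edges. In the strong Ramsey game $\mathcal R^{(k)}(\mathcal H,\aleph_0)$ two players, the first player FP and the second player SP, alternately claim previously unclaimed $k$-element subsets of $\mathbb N$, one per move, FP moving first; the first player whose claimed sets contain all edges of a copy of $\mathcal H$ wins. The game is a draw if neither player has a strategy ensuring that he wins after finitely many moves. A $k$-graph $\mathcal F$ has a fast winning strategy if a player who alternates moves with an opponent on this board can always build a copy of $\mathcal F$ in his first $|E(\mathcal F)|$ moves, regardless of what the opponent builds. (On this infinite board it makes no difference which of the two moves first.) Suppose that $\mathcal H$ satisfies the following. (i) $\mathcal H$ has a vertex $z$ of degree $2$; let $r$ and $g$ be the two edges containing $z$. (ii) $\delta(\mathcal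 H\setminus\{z\})\ge 3$, and $d_{\mathcal H}(u)\ge 4$ for every $u\in V(\mathcal H)\setminus\{z\}$. (iii) $\mathcal H\setminus\{z\}$ has a fast winning strategy. (iv) For every two distinct edges $e,e'\in E(\mathcal H)$, every monomorphism $\phi:V(\mathcal H\setminus\{e,e'\})\to V(\mathcal H)$ is the identity, i.e. $\phi(v)=v$ for all $v\in V(\mathcal H\setminus\{e,e'\})$. (v) $e\cap r\ne\emptyset$ and $e\cap g\neq\emptyset$ for every edge $e\in E(\mathcal H)$. (vi) $|V(\mathcal H)\setminus(r\cup g)|<k-1$. Then $\mathcal R^{(k)}(\mathcal H,\aleph_0)$ is a draw. Moreover, SP has a drawing strategy, that is, a strategy ensuring that FP never wins. -/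

import Mathlib

namespace RamseyGame

/-- A finite `k`-uniform hypergraph (a `k`-graph) with vertices in `V`. -/
structure KGraph (k : ℕ) (V : Type*) where
  verts : Finset V
  edges : Finset (Finset V)
  edge_subset : ∀ e ∈ edges, e ⊆ verts
  uniform : ∀ e ∈ edges, e.card = k

namespace KGraph

variable {k : ℕ} {V W : Type*} [DecidableEq V] [DecidableEq W]

/-- The edges incident with the vertex `x`. -/
def incidentEdges (H : KGraph k V) (x : V) : Finset (Finset V) :=
  H.edges.filter fun e => x ∈ e

/-- The degree of `x`: the number of edges incident with `x`. -/
def degree (H : KGraph k V) (x : V) : ℕ :=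
  (H.incidentEdges x).card

/-- `H ∖ {z}`: delete the vertex `z` together with all edges incident with it. -/
def deleteVertex (H : KGraph k V) (z : V) : KGraph k V where
  verts := H.verts.erase z
  edges := H.edges.filter fun e => z ∉ e
  edge_subset := fun e he x hx => by
    rw [Finset.mem_filter] at he
    exact Finset.mem_erase.2
      ⟨fun h => he.2 (h ▸ hx), H.edge_subset e he.1 hx⟩
  uniform := fun e he => H.uniform e (Finset.mem_filter.1 he).1

/-- `H ∖ S` for a set `S` of edges: the `k`-graph spanned by the edges that are not in `S`.
Its vertices are those lying on at least one remaining edge. -/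
def deleteEdges (H : KGraph k V) (S : Finset (Finset V)) : KGraph k V where
  verts := (H.edges \ S).biUnion id
  edges := H.edges \ S
  edge_subset := fun e he _ hx => Finset.mem_biUnion.2 ⟨e, he, hx⟩
  uniform := fun e he => H.uniform e (Finset.mem_sdiff.1 he).1

/-- `φ` restricts to a monomorphism `V(F) → V(G)`: it is injective on the vertices of `F` and
sends edges of `F` to edges of `G`. The values of `φ` off `V(F)` play no role. -/
def IsMonomorphism (F : KGraph k V) (G : KGraph k W) (φ : V → W) : Prop :=
  (∀ v ∈ F.verts, φ v ∈ G.verts) ∧ Set.InjOn φ F.verts ∧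
    ∀ e ∈ F.edges, e.image φ ∈ G.edges

end KGraph

/-- The board: the edges of the complete `k`-uniform hypergraph on `ℕ`. -/
abbrev BoardEdge (k : ℕ) : Type := {e : Finset ℕ // e.card = k}

/-- The set `A` of board edges contains all edges of some copy of `F`. -/
def ContainsCopy {k : ℕ} {V : Type*} (F : KGraph k V) (A : Set (BoardEdge k)) : Prop :=
  ∃ f : V → ℕ, Set.InjOn f F.verts ∧
    ∀ e ∈ F.edges, ∃ a ∈ A, a.1 = e.image f

inductive Player where
  | first
  | second

/-- The opponent of a player. -/
def Player.other : Player → Player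
  | .first => .second
  | .second => .first

/-- Moves are numbered `0, 1, 2, …`; the first player makes the even-numbered ones. -/
def turn (i : ℕ) : Player :=
  if Even i then .first else .second

/-- An infinite legal sequence of moves: each move claims a previously unclaimed board edge. (The
game is decided by the first completed copy; moves after that have no effect.) -/
def IsPlay {k : ℕ} (p : ℕ → BoardEdge k) : Prop :=
  ∀ i j, i < j → p i ≠ p j

/-- The list of the first `n` moves. -/
def history {k : ℕ} (p : ℕ → BoardEdge k) (n : ℕ) : List (BoardEdge k) :=
  (List.range n).map p

/-- A strategy: given the list of all moves made so far by both players, it names a board edge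
that is still unclaimed. -/
structure Strategy (k : ℕ) where
  move : List (BoardEdge k) → BoardEdge k
  legal : ∀ h, move h ∉ h

/-- In the play `p`, player `P` makes all of his moves according to `s`. -/
def Follows {k : ℕ} (s : Strategy k) (P : Player) (p : ℕ → BoardEdge k) : Prop :=
  ∀ i, turn i = P → p i = s.move (history p i)

/-- The edges claimed by player `P` among the first `n` moves of the play `p`. -/
def claimed {k : ℕ} (P : Player) (p : ℕ → BoardEdge k) (n : ℕ) : Set (BoardEdge k) :=
  {a | ∃ i < n, turn i = P ∧ p i = a}

section Game

variable {k : ℕ} {V : Type*}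

/-- Player `P` wins the play `p` of the strong game `R^(k)(H, ℵ₀)`: after finitely many moves his
edges contain a copy of `H` while those of his opponent do not. -/
def Wins (H : KGraph k V) (P : Player) (p : ℕ → BoardEdge k) : Prop :=
  ∃ n, ContainsCopy H (claimed P p n) ∧ ¬ ContainsCopy H (claimed P.other p n)

/-- `P` has a strategy that ensures his win, in finitely many moves, against every opponent. -/
def HasWinningStrategy (H : KGraph k V) (P : Player) : Prop :=
  ∃ s : Strategy k, ∀ p, IsPlay p → Follows s P p → Wins H P p

/-- `P` has a strategy that ensures that his opponent never wins. -/
def HasDrawingStrategy (H : KGraph k V) (P : Player) : Prop :=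
  ∃ s : Strategy k, ∀ p, IsPlay p → Follows s P p → ¬ Wins H P.other p

/-- The strong game `R^(k)(H, ℵ₀)` is a draw: no player has a winning strategy. -/
def IsDraw (H : KGraph k V) : Prop :=
  ∀ P : Player, ¬ HasWinningStrategy H P

/-- `F` has a fast winning strategy: a player can build a copy of `F` within his first `|E(F)|`
moves, whatever the opponent claims (and regardless of what the opponent builds). The player is
taken to move first. On the infinite board this is equivalent to the version where he moves second:
an extra edge claimed by the opponent, or a missing one, can be moved out of the way. -/
def HasFastWinningStrategy (F : KGraph k V) : Prop :=
  ∃ s : Strategy k, ∀ p, IsPlay p → Follows s .first p →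
    ContainsCopy F (claimed .first p (2 * F.edges.card))

end Game

end RamseyGame

/-! The second player ignores the first edge `e` of his opponent and quickly builds a copy `f` of
`H ∖ {z}` away from `e`. If his opponent then has no threat, he claims the image of `r` at one new
vertex after another. Each of these moves threatens to complete `H` with the image of `g` at the
same vertex, so the opponent must claim that edge, and he never gets a move to spare. He gains no
threat by these replies, as such a threat would need a copy of `H ∖ {z}` whose two edges at the
pivot fit those of `f`; either no copy fits, or exchanging `r` and `g` helps.

If the opponent has a threat, then all of his edges lie on the threatened copy `ψ` of `H`. By
rigidity and the degree conditions, every later threat of his is a copy of `H` that agrees with `ψ`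
off `z`, so that each of them is stopped by claiming the partner of the edge he has just claimed at
a new vertex. He can thus be answered until he makes a move without a threat. As `e` lies in the
image of `ψ` and misses `f`, the image of `ψ` is too small to contain both edges of `f` at the
pivot, so one of the two orders of `r` and `g` is safe. -/

namespace RamseyGame

open Finset

section Plays

variable {k : ℕ} {P Q : Player} {p : ℕ → BoardEdge k} {n : ℕ} {h : List (BoardEdge k)}

theorem Player.other_ne (P : Player) : P.other ≠ P := by cases P <;> nofun

theorem Player.other_other (P : Player) : P.other.other = P := by cases P <;> rfl

theorem Player.eq_other_of_ne (h : Q ≠ P) : Q = P.other := by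
  cases P <;> cases Q <;> first | rfl | exact absurd rfl h

theorem turn_zero : turn 0 = .first := if_pos Even.zero

theorem turn_succ (n : ℕ) : turn (n + 1) = (turn n).other := by
  by_cases hn : Even n <;> simp [turn, Player.other, Nat.even_add_one, hn]

theorem turn_add_two (n : ℕ) : turn (n + 2) = turn n := by
  rw [turn_succ, turn_succ, Player.other_other]

theorem history_succ (p : ℕ → BoardEdge k) (n : ℕ) :
    history p (n + 1) = history p n ++ [p n] := by
  simp [history, List.range_succ]

theorem length_history (p : ℕ → BoardEdge k) (n : ℕ) : (history p n).length = n := by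
  simp [history]

theorem isPlay_iff : IsPlay p ↔ ∀ n, p n ∉ history p n := by
  simp only [IsPlay, history, List.mem_map, List.mem_range, not_exists, not_and]
  exact forall_comm

theorem Strategy.ne_zero (s : Strategy k) : k ≠ 0 := by
  rintro rfl
  have hmove : s.move [⟨∅, rfl⟩] = ⟨∅, rfl⟩ := Subtype.ext (card_eq_zero.1 (s.move _).2)
  exact s.legal [⟨∅, rfl⟩] (by simp [hmove])

theorem exists_edge_notMem (hk : k ≠ 0) (S : Finset (Finset ℕ)) :
    ∃ c : Finset ℕ, c.card = k ∧ c ∉ S := by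
  have : NeZero k := ⟨hk⟩
  have hinf : (Set.powersetCard ℕ k).Infinite := Set.infinite_coe_iff.1 inferInstance
  exact hinf.exists_notMem_finset S

theorem exists_strategy (hk : k ≠ 0) (R : List (BoardEdge k) → BoardEdge k → Prop) :
    ∃ s : Strategy k, ∀ h, (∃ c ∉ h, R h c) → R h (s.move h) := by
  have hmove : ∀ h, ∃ c ∉ h, (∃ c ∉ h, R h c) → R h c := fun h => by
    by_cases hR : ∃ c ∉ h, R h c
    · obtain ⟨c, hc, hcR⟩ := hR
      exact ⟨c, hc, fun _ => hcR⟩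
    · obtain ⟨c, hck, hc⟩ := exists_edge_notMem hk (h.map Subtype.val).toFinset
      exact ⟨⟨c, hck⟩, fun hch => hc (by simp [hck, hch]), fun h' => absurd h' hR⟩
  choose move legal hmove using hmove
  exact ⟨⟨move, legal⟩, hmove⟩

open Classical in
theorem exists_play (P : Player) (s s' : Strategy k) :
    ∃ p, IsPlay p ∧ Follows s P p ∧ Follows s' P.other p := by
  let σ : List (BoardEdge k) → BoardEdge k := fun h =>
    if turn h.length = P then s.move h else s'.move h
  let l : ℕ → List (BoardEdge k) := fun n => n.rec [] fun _ h => h ++ [σ h]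
  let p : ℕ → BoardEdge k := fun n => σ (l n)
  have hl : ∀ n, history p n = l n := fun n => by
    induction n with
    | zero => rfl
    | succ n ih => rw [history_succ, ih]
  have hp : ∀ n, p n = if turn n = P then s.move (history p n) else s'.move (history p n) :=
    fun n => by
      rw [hl]
      simp only [p, σ]
      rw [← hl, length_history]
  refine ⟨p, isPlay_iff.2 fun n => ?_, fun n hn => by rw [hp, if_pos hn], fun n hn => ?_⟩
  · rw [hp]
    split_ifs
    exacts [s.legal _, s'.legal _]
  · rw [hp, if_neg (hn ▸ P.other_ne)]

open Classical in
/-- The vertex sets of the edges that `P` has claimed when the list of all moves so far is `h`. -/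
noncomputable def side (P : Player) (h : List (BoardEdge k)) : Finset (Finset ℕ) :=
  ((h.zipIdx.filter fun q => turn q.2 = P).map fun q => q.1.1).toFinset

theorem mem_side {x : Finset ℕ} :
    x ∈ side P h ↔ ∃ i a, h[i]? = some a ∧ turn i = P ∧ a.1 = x := by
  simp only [side, List.mem_toFinset, List.mem_map, List.mem_filter, List.mem_zipIdx_iff_getElem?,
    decide_eq_true_eq, Prod.exists, and_assoc]
  exact exists_comm

theorem side_nil : side P ([] : List (BoardEdge k)) = ∅ := by simp [side]

theorem side_append_of_turn {a : BoardEdge k} (ht : turn h.length = P) :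
    side P (h ++ [a]) = insert a.1 (side P h) := by
  ext x
  simp [side, List.zipIdx_append, ht]

theorem side_append_of_turn_ne {a : BoardEdge k} (ht : turn h.length ≠ P) :
    side P (h ++ [a]) = side P h := by
  ext x
  simp [side, List.zipIdx_append, ht]

theorem side_other_append {a : BoardEdge k} (ht : turn h.length = P) :
    side P.other (h ++ [a]) = side P.other h :=
  side_append_of_turn_ne (ht ▸ P.other_ne.symm)

theorem side_append_append {a b : BoardEdge k} (ht : turn h.length = P) :
    side P (h ++ [a] ++ [b]) = insert a.1 (side P h) := by
  rw [side_append_of_turn_ne, side_append_of_turn ht]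
  rw [List.length_append, List.length_singleton, turn_succ, ht]
  exact P.other_ne

theorem side_other_append_append {a b : BoardEdge k} (ht : turn h.length = P) :
    side P.other (h ++ [a] ++ [b]) = insert b.1 (side P.other h) := by
  rw [side_append_of_turn, side_other_append ht]
  rw [List.length_append, List.length_singleton, turn_succ, ht]

theorem side_first_singleton (a : BoardEdge k) : side .first [a] = {a.1} :=
  (side_append_of_turn (h := []) turn_zero).trans (by rw [side_nil, insert_empty])

theorem side_second_singleton (a : BoardEdge k) : side .second [a] = ∅ :=
  (side_append_of_turn_ne (h := []) (by simp [turn])).trans side_nil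

theorem mem_side_history {x : Finset ℕ} :
    x ∈ side P (history p n) ↔ ∃ a ∈ claimed P p n, a.1 = x := by
  rw [mem_side]
  constructor
  · rintro ⟨i, a, hi, ht, rfl⟩
    obtain ⟨hin, rfl⟩ := List.getElem?_eq_some_iff.1 hi
    exact ⟨_, ⟨i, length_history p n ▸ hin, ht, by simp [history]⟩, rfl⟩
  · rintro ⟨_, ⟨i, hi, ht, rfl⟩, rfl⟩
    exact ⟨i, p i, by simp [history, hi], ht, rfl⟩

theorem mem_iff_mem_side (P : Player) {a : BoardEdge k} :
    a ∈ h ↔ a.1 ∈ side P.other h ∨ a.1 ∈ side P h := by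
  simp only [mem_side]
  constructor
  · intro ha
    obtain ⟨i, hi⟩ := List.mem_iff_getElem?.1 ha
    by_cases ht : turn i = P
    · exact Or.inr ⟨i, a, hi, ht, rfl⟩
    · exact Or.inl ⟨i, a, hi, Player.eq_other_of_ne ht, rfl⟩
  · rintro (⟨i, b, hi, -, hab⟩ | ⟨i, b, hi, -, hab⟩) <;>
      exact Subtype.ext hab ▸ List.mem_of_getElem? hi

theorem card_side_second_history_le (p : ℕ → BoardEdge k) (n : ℕ) :
    (side .second (history p (2 * n + 1))).card ≤ n := by
  change (side (Player.other .first) _).card ≤ n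
  have ht : ∀ m, turn (history p (2 * m)).length = .first := fun m => by
    rw [length_history]
    exact if_pos (even_two_mul m)
  rw [history_succ, side_other_append (ht n)]
  induction n with
  | zero => rw [history, List.range_zero, List.map_nil, side_nil, card_empty]
  | succ n ih =>
    rw [Nat.mul_succ, history_succ, history_succ, side_other_append_append (ht n)]
    exact (card_insert_le _ _).trans (Nat.succ_le_succ ih)

end Plays

section Copies

variable {k : ℕ} {V : Type*} {F : KGraph k V} {f : V → ℕ} {A A' : Finset (Finset ℕ)}

/-- `f` embeds `F` into the family `A`, viewed as the edge set of a hypergraph on `ℕ`. -/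
def EmbedsVia (F : KGraph k V) (f : V → ℕ) (A : Finset (Finset ℕ)) : Prop :=
  Set.InjOn f F.verts ∧ ∀ e ∈ F.edges, e.image f ∈ A

/-- `A` contains a copy of `F`: the finite-position counterpart of `ContainsCopy`. -/
def HasCopy (F : KGraph k V) (A : Finset (Finset ℕ)) : Prop :=
  ∃ f, EmbedsVia F f A

/-- `B` contains a copy of `F` none of whose vertices lies in `e`. -/
def HasCopyAvoiding (F : KGraph k V) (e : Finset ℕ) (B : Finset (Finset ℕ)) : Prop :=
  ∃ f, EmbedsVia F f B ∧ ∀ v, f v ∉ e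

theorem EmbedsVia.mono (h : EmbedsVia F f A) (hA : A ⊆ A') : EmbedsVia F f A' :=
  ⟨h.1, fun e he => hA (h.2 e he)⟩

theorem HasCopy.mono (h : HasCopy F A) (hA : A ⊆ A') : HasCopy F A' :=
  h.imp fun _ hf => hf.mono hA

theorem HasCopyAvoiding.mono {e : Finset ℕ} (h : HasCopyAvoiding F e A) (hA : A ⊆ A') :
    HasCopyAvoiding F e A' :=
  h.imp fun _ hf => ⟨hf.1.mono hA, hf.2⟩

theorem EmbedsVia.comp {B : Finset (Finset ℕ)} {ι : ℕ → ℕ} (hf : EmbedsVia F f B)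
    (hι : Function.Injective ι) (hB : ∀ x ∈ B, x.image ι ∈ A) : EmbedsVia F (ι ∘ f) A :=
  ⟨hι.comp_injOn hf.1, fun e he => by simpa only [image_image] using hB _ (hf.2 e he)⟩

theorem containsCopy_claimed_iff {P : Player} {p : ℕ → BoardEdge k} {n : ℕ} :
    ContainsCopy F (claimed P p n) ↔ HasCopy F (side P (history p n)) := by
  simp only [ContainsCopy, HasCopy, EmbedsVia, mem_side_history]

theorem side_history_mono (P : Player) (p : ℕ → BoardEdge k) {m n : ℕ} (h : m ≤ n) :
    side P (history p m) ⊆ side P (history p n) := by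
  intro x
  rw [mem_side_history, mem_side_history]
  rintro ⟨a, ⟨i, hi, ha⟩, hax⟩
  exact ⟨a, ⟨i, hi.trans_le h, ha⟩, hax⟩

theorem Wins.exists_turn {P : Player} {p : ℕ → BoardEdge k} (h : Wins F P p) :
    ∃ n, turn n = P ∧ HasCopy F (side P (history p (n + 1))) ∧
      ¬ HasCopy F (side P.other (history p (n + 1))) := by
  classical
  obtain ⟨N, hN, hN'⟩ := h
  rw [containsCopy_claimed_iff] at hN hN'
  have hex : ∃ n, HasCopy F (side P (history p n)) := ⟨N, hN⟩
  obtain ⟨n, hn⟩ : ∃ n, Nat.find hex = n + 1 := by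
    refine Nat.exists_eq_succ_of_ne_zero fun h0 => hN' ?_
    have hcopy := Nat.find_spec hex
    rw [h0, history, List.range_zero, List.map_nil, side_nil] at hcopy
    exact hcopy.mono (empty_subset _)
  have hcopy : HasCopy F (side P (history p (n + 1))) := hn ▸ Nat.find_spec hex
  refine ⟨n, ?_, hcopy, fun h => hN' (h.mono (side_history_mono _ p (hn ▸ Nat.find_min' hex hN)))⟩
  by_contra ht
  refine Nat.find_min hex (m := n) (by omega) ?_
  rwa [history_succ, side_append_of_turn_ne (by rwa [length_history])] at hcopy

end Copies

section Forcing

variable {k : ℕ} {A B A' B' : Finset (Finset ℕ)} {c b : Finset ℕ} {ι : ℕ → ℕ}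
  {T T' : Finset (Finset ℕ) → Finset (Finset ℕ) → Prop}

/-- `c` may be claimed when the two players hold `A` and `B`. -/
structure Unclaimed (k : ℕ) (A B : Finset (Finset ℕ)) (c : Finset ℕ) : Prop where
  card_eq : c.card = k
  notMem_left : c ∉ A
  notMem_right : c ∉ B

theorem Unclaimed.symm (h : Unclaimed k A B c) : Unclaimed k B A c :=
  ⟨h.1, h.3, h.2⟩

theorem exists_unclaimed (hk : k ≠ 0) (A B : Finset (Finset ℕ)) : ∃ c, Unclaimed k A B c := by
  obtain ⟨c, hck, hc⟩ := exists_edge_notMem hk (A ∪ B)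
  rw [notMem_union] at hc
  exact ⟨c, hck, hc.1, hc.2⟩

theorem unclaimed_side_iff (P : Player) {h : List (BoardEdge k)} {a : BoardEdge k} :
    Unclaimed k (side P.other h) (side P h) a.1 ↔ a ∉ h := by
  rw [mem_iff_mem_side P, not_or]
  exact ⟨fun h => ⟨h.2, h.3⟩, fun h => ⟨a.2, h.1, h.2⟩⟩

/-- The player who holds `B`, on turn against an opponent holding `A`, has a move after which every
reply leads to a position satisfying `R`. In all such relations between positions the edges of
the opponent come first. -/
def ForcesNext (k : ℕ) (R : Finset (Finset ℕ) → Finset (Finset ℕ) → Prop)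
    (A B : Finset (Finset ℕ)) : Prop :=
  ∃ c, Unclaimed k A B c ∧ ∀ b, Unclaimed k A (insert c B) b → R (insert b A) (insert c B)

theorem ForcesNext.disjoint (hAB : Disjoint A B) (h : ForcesNext k T A B) :
    ForcesNext k (fun A B => Disjoint A B ∧ T A B) A B := by
  obtain ⟨c, hc, hnext⟩ := h
  refine ⟨c, hc, fun b hb => ⟨?_, hnext b hb⟩⟩
  exact disjoint_insert_left.2 ⟨hb.3, disjoint_insert_right.2 ⟨hc.2, hAB⟩⟩

theorem ForcesNext.imp (h : ForcesNext k T A B) (hT : ∀ A B, T A B → T' A B) :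
    ForcesNext k T' A B := by
  obtain ⟨c, hc, hnext⟩ := h
  exact ⟨c, hc, fun b hb => hT _ _ (hnext b hb)⟩

/-- The player who holds `B`, on turn against an opponent holding `A`, can force a move of his own
that leads to a position satisfying `T`. -/
inductive Forces (k : ℕ) (T : Finset (Finset ℕ) → Finset (Finset ℕ) → Prop) :
    Finset (Finset ℕ) → Finset (Finset ℕ) → Prop
  | finish {A B : Finset (Finset ℕ)} {c : Finset ℕ} (hc : Unclaimed k A B c)
      (hT : T A (insert c B)) : Forces k T A B
  | move {A B : Finset (Finset ℕ)} {c : Finset ℕ} (hc : Unclaimed k A B c)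
      (hnext : ∀ b, Unclaimed k A (insert c B) b → Forces k T (insert b A) (insert c B)) :
      Forces k T A B

theorem Forces.exists_superset (hk : k ≠ 0) (h : Forces k T A B) :
    ∃ A' B', A ⊆ A' ∧ T A' B' := by
  induction h with
  | finish _ hT => exact ⟨_, _, Subset.rfl, hT⟩
  | @move A B c _ _ ih =>
    obtain ⟨b, hb⟩ := exists_unclaimed hk A (insert c B)
    obtain ⟨A', B', hA, hT⟩ := ih b hb
    exact ⟨A', B', (subset_insert b A).trans hA, hT⟩

/-- The position `(A', B')` is at least as good for the player on turn as the image of `(A, B)`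
under `ι`, up to one further edge of the opponent. -/
structure Dominates (ι : ℕ → ℕ) (A B A' B' : Finset (Finset ℕ)) : Prop where
  image_mem : ∀ x ∈ B, x.image ι ∈ B'
  mem_of_image_mem : ∀ x : Finset ℕ, x.image ι ∈ A' → x ∈ A
  card_le : A'.card ≤ A.card + 1

theorem Dominates.exists_move (hk : k ≠ 0) (h : Dominates ι A B A' B')
    (hι : Function.Injective ι) (hc : Unclaimed k A B c) :
    ∃ c', Unclaimed k A' B' c' ∧ Dominates ι A (insert c B) A' (insert c' B') := by
  obtain ⟨c', hc', hcc'⟩ : ∃ c', Unclaimed k A' B' c' ∧ c.image ι ∈ insert c' B' := by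
    by_cases hcB : c.image ι ∈ B'
    · obtain ⟨c', hc'⟩ := exists_unclaimed hk A' B'
      exact ⟨c', hc', mem_insert_of_mem hcB⟩
    · exact ⟨c.image ι, ⟨card_image_of_injective c hι ▸ hc.1,
        fun hcA => hc.2 (h.mem_of_image_mem c hcA), hcB⟩, mem_insert_self _ _⟩
  refine ⟨c', hc', fun x hx => ?_, h.2, h.3⟩
  rcases mem_insert.1 hx with rfl | hxB
  exacts [hcc', mem_insert_of_mem (h.image_mem x hxB)]

theorem Dominates.exists_reply (hk : k ≠ 0) (h : Dominates ι A B A' B')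
    (hι : Function.Injective ι) {b' : Finset ℕ} (hb' : Unclaimed k A' B' b') :
    ∃ b, Unclaimed k A B b ∧ Dominates ι (insert b A) B (insert b' A') B' := by
  obtain ⟨b, hb, hbb'⟩ : ∃ b, Unclaimed k A B b ∧
      ∀ x : Finset ℕ, x.image ι = b' → x ∈ insert b A := by
    by_cases hx : ∃ x : Finset ℕ, x.image ι = b' ∧ x ∉ A
    · obtain ⟨x, rfl, hxA⟩ := hx
      refine ⟨x, ⟨card_image_of_injective x hι ▸ hb'.1, hxA,
        fun hxB => hb'.3 (h.image_mem x hxB)⟩, fun y hy => ?_⟩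
      rw [image_injective hι hy]
      exact mem_insert_self x A
    · push Not at hx
      obtain ⟨b, hb⟩ := exists_unclaimed hk A B
      exact ⟨b, hb, fun x hxb => mem_insert_of_mem (hx x hxb)⟩
  refine ⟨b, hb, h.1, fun x hx => ?_, ?_⟩
  · rcases mem_insert.1 hx with hxb | hxA
    exacts [hbb' x hxb, mem_insert_of_mem (h.mem_of_image_mem x hxA)]
  · rw [card_insert_of_notMem hb.2, card_insert_of_notMem hb'.2]
    exact Nat.succ_le_succ h.3

theorem Forces.simulate (hk : k ≠ 0) (hι : Function.Injective ι) (h : Forces k T A B)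
    (hdom : Dominates ι A B A' B')
    (hT : ∀ A B A' B', Dominates ι A B A' B' → T A B → T' A' B') : Forces k T' A' B' := by
  induction h generalizing A' B' with
  | finish hc hTc =>
    obtain ⟨c', hc', hdom'⟩ := hdom.exists_move hk hι hc
    exact .finish hc' (hT _ _ _ _ hdom' hTc)
  | move hc _ ih =>
    obtain ⟨c', hc', hdom'⟩ := hdom.exists_move hk hι hc
    refine .move hc' fun b' hb' => ?_
    obtain ⟨b, hb, hdom''⟩ := hdom'.exists_reply hk hι hb'
    exact ih b hb hdom''

end Forcing

section Strategies

variable {k : ℕ} {V : Type*} {F : KGraph k V} {P : Player} {A B : Finset (Finset ℕ)}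
  {T : Finset (Finset ℕ) → Finset (Finset ℕ) → Prop}

theorem exists_reply_of_not_forces {h : List (BoardEdge k)} {a : BoardEdge k}
    (hF : ¬ Forces k T (side P.other h) (side P h)) (ht : turn h.length = P) (ha : a ∉ h) :
    ∃ b ∉ h ++ [a], ¬ Forces k T (side P.other (h ++ [a] ++ [b])) (side P (h ++ [a] ++ [b])) := by
  by_contra! hall
  refine hF (.move ((unclaimed_side_iff P).2 ha) fun b hb => ?_)
  rw [← side_append_of_turn ht, ← side_other_append (a := a) ht] at hb
  have hforces := hall ⟨b, hb.1⟩ ((unclaimed_side_iff P (a := ⟨b, hb.1⟩)).1 hb)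
  rwa [side_other_append_append ht, side_append_append ht] at hforces

-- Otherwise the opponent could keep the position such that `T` cannot be forced.
theorem forces_of_forall_play (s : Strategy k)
    (hs : ∀ p, IsPlay p → Follows s P p → ∃ n, turn n = P ∧
      T (side P.other (history p (n + 1))) (side P (history p (n + 1))))
    {h : List (BoardEdge k)} (hlen : h.length ≤ 1) (ht : turn h.length = P) :
    Forces k T (side P.other h) (side P h) := by
  by_contra hF
  obtain ⟨s', hs'⟩ := exists_strategy s.ne_zero fun h b =>
    ¬ Forces k T (side P.other (h ++ [b])) (side P (h ++ [b]))
  obtain ⟨p, hp, hps, hps'⟩ := exists_play P s s'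
  have hnot : ∀ n, turn n = P →
      ¬ Forces k T (side P.other (history p n)) (side P (history p n)) := by
    intro n
    induction n using Nat.twoStepInduction with
    | zero =>
      intro hn
      rcases h with _ | ⟨a, _ | ⟨b, h⟩⟩
      · exact hF
      · exact absurd (hn.trans ht.symm) (by simp [turn])
      · simp at hlen
    | one =>
      intro hn
      rcases h with _ | ⟨a, _ | ⟨b, h⟩⟩
      · exact absurd (hn.trans ht.symm) (by simp [turn])
      · have hfirst := hps' 0 (by rw [← hn]; simp [turn, Player.other])
        change ¬ Forces k T (side P.other [p 0]) (side P [p 0])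
        rw [hfirst]
        exact hs' [] ⟨a, List.not_mem_nil, hF⟩
      · simp at hlen
    | more n ih _ =>
      intro hn
      rw [turn_add_two] at hn
      have hlast := hps' (n + 1) (by rw [turn_succ, hn])
      rw [history_succ, history_succ, hlast, history_succ]
      exact hs' _ (exists_reply_of_not_forces (ih hn) (by rwa [length_history])
        (isPlay_iff.1 hp n))
  obtain ⟨n, hn, hT⟩ := hs p hp hps
  have hlen : turn (history p n).length = P := by rwa [length_history]
  rw [history_succ, side_other_append hlen, side_append_of_turn hlen] at hT
  exact hnot n hn (.finish ((unclaimed_side_iff P).2 (isPlay_iff.1 hp n)) hT)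

theorem HasFastWinningStrategy.forces (h : HasFastWinningStrategy F) (hF : F.edges.Nonempty) :
    Forces k (fun A B => HasCopy F B ∧ A.card < F.edges.card) ∅ ∅ := by
  obtain ⟨s, hs⟩ := h
  obtain ⟨m, hm⟩ := Nat.exists_eq_add_one.2 hF.card_pos
  refine forces_of_forall_play (P := .first) (h := []) s (fun p hp hps => ⟨2 * m, ?_, ?_, ?_⟩)
    (by simp) turn_zero
  · exact if_pos (even_two_mul m)
  · have hcopy := containsCopy_claimed_iff.1 (hs p hp hps)
    rwa [hm, Nat.mul_succ, history_succ, side_append_of_turn_ne] at hcopy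
    rw [length_history]
    simp [turn]
  · exact hm ▸ Nat.lt_succ_of_le (card_side_second_history_le p m)

theorem HasFastWinningStrategy.forces_avoiding (hk : k ≠ 0) (h : HasFastWinningStrategy F)
    (hF : F.edges.Nonempty) {e : Finset ℕ} (he : e.Nonempty) :
    Forces k (fun A B => HasCopyAvoiding F e B ∧ A.card ≤ F.edges.card) {e} ∅ := by
  obtain ⟨N, hN⟩ : ∃ N, ∀ n, n + N ∉ e :=
    ⟨e.sup id + 1, fun n hn => by
      have hle : n + (e.sup id + 1) ≤ e.sup id := le_sup (f := id) hn
      omega⟩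
  refine (h.forces hF).simulate hk (add_left_injective N) ⟨by simp, fun x hx => ?_, by simp⟩ ?_
  · obtain ⟨v, hv⟩ := he
    obtain rfl := mem_singleton.1 hx
    rw [mem_image] at hv
    obtain ⟨n, hn, rfl⟩ := hv
    exact absurd (mem_image_of_mem _ hn) (hN n)
  · rintro A B A' B' hdom ⟨⟨f, hf⟩, hA⟩
    exact ⟨⟨_, hf.comp (add_left_injective N) hdom.image_mem, fun v => hN (f v)⟩,
      hdom.card_le.trans hA⟩

theorem Forces.not_hasCopy (hk : k ≠ 0)
    (h : Forces k (fun A B => HasCopy F B ∧ ¬ HasCopy F A) A B) : ¬ HasCopy F A := by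
  obtain ⟨A', B', hA, -, hA'⟩ := h.exists_superset hk
  exact fun hcopy => hA' (hcopy.mono hA)

theorem Forces.exists_not_forces (hk : k ≠ 0)
    (h : Forces k (fun A B => HasCopy F B ∧ ¬ HasCopy F A) A B) :
    ∃ c, Unclaimed k A B c ∧
      ¬ Forces k (fun A B => HasCopy F B ∧ ¬ HasCopy F A) (insert c B) A := by
  induction h with
  | @finish A B c hc hT => exact ⟨c, hc, fun hopp => hopp.not_hasCopy hk hT.1⟩
  | @move A B c hc hnext ih =>
    refine ⟨c, hc, fun hopp => ?_⟩
    cases hopp with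
    | finish hb hT => exact (hnext _ hb.symm).not_hasCopy hk hT.1
    | move hb hnext' =>
      obtain ⟨c', hc', hnot⟩ := ih _ hb.symm
      exact hnot (hnext' c' hc'.symm)

-- Strategy stealing: the first player opens anywhere and then plays as if his opponent had opened.
theorem not_hasWinningStrategy_second (F : KGraph k V) : ¬ HasWinningStrategy F .second := by
  rintro ⟨s, hs⟩
  have hk := s.ne_zero
  have hsecond : ∀ a : Finset ℕ, a.card = k →
      Forces k (fun A B => HasCopy F B ∧ ¬ HasCopy F A) {a} ∅ := fun a ha => by
    rw [← side_first_singleton ⟨a, ha⟩, ← side_second_singleton ⟨a, ha⟩]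
    exact forces_of_forall_play (P := .second) s (fun p hp hps => (hs p hp hps).exists_turn) le_rfl
      (by simp [turn])
  have hfirst : Forces k (fun A B => HasCopy F B ∧ ¬ HasCopy F A) ∅ ∅ := by
    obtain ⟨a, ha⟩ := exists_unclaimed hk ∅ ∅
    refine .move ha fun b hb => ?_
    refine (hsecond b hb.1).simulate hk Function.injective_id (B' := {a}) ?_ ?_
    · exact ⟨by simp, by simp, by simp⟩
    · rintro A B A' B' hdom ⟨hB, hA⟩
      exact ⟨hB.mono fun x hx => by simpa using hdom.image_mem x hx,
        fun hA' => hA (hA'.mono fun x hx => hdom.mem_of_image_mem x (by simpa using hx))⟩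
  obtain ⟨c, hc, hnot⟩ := hfirst.exists_not_forces hk
  exact hnot (hsecond c hc.1)

theorem not_hasWinningStrategy_of_hasDrawingStrategy (h : HasDrawingStrategy F P.other) :
    ¬ HasWinningStrategy F P := by
  rintro ⟨s, hs⟩
  obtain ⟨s', hs'⟩ := h
  obtain ⟨p, hp, hps, hps'⟩ := exists_play P s s'
  exact hs' p hp hps' (P.other_other.symm ▸ hs p hp hps)

theorem exists_strategy_second_of_invariant (hk : k ≠ 0)
    (Good : Finset (Finset ℕ) → Finset (Finset ℕ) → Prop)
    (hstart : ∀ a : Finset ℕ, a.card = k → Good {a} ∅)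
    (hstep : ∀ A B, Good A B → ForcesNext k Good A B) :
    ∃ s : Strategy k, ∀ p, IsPlay p → Follows s .second p → ∀ n, turn n = .second →
      Good (side .first (history p n)) (side .second (history p n)) := by
  obtain ⟨s, hs⟩ := exists_strategy hk fun h c => ∀ b ∉ h ++ [c],
    Good (side .first (h ++ [c] ++ [b])) (side .second (h ++ [c] ++ [b]))
  refine ⟨s, fun p hp hps n => ?_⟩
  induction n using Nat.twoStepInduction with
  | zero => rw [turn_zero]; nofun
  | one =>
    intro _
    change Good (side .first [p 0]) (side .second [p 0])
    rw [side_first_singleton, side_second_singleton]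
    exact hstart _ (p 0).2
  | more n ih _ =>
    intro hn
    rw [turn_add_two] at hn
    have hlen : turn (history p n).length = .second := by rwa [length_history]
    obtain ⟨c, hc, hnext⟩ := hstep _ _ (ih hn)
    have hmove := hs (history p n) ⟨⟨c, hc.1⟩, (unclaimed_side_iff .second).1 hc, fun b hb => by
      have hb' := (unclaimed_side_iff .second).2 hb
      rw [side_other_append hlen, side_append_of_turn hlen] at hb'
      change Good (side (Player.other .second) _) _
      rw [side_other_append_append hlen, side_append_append hlen]
      exact hnext b.1 hb'⟩
    rw [← hps n hn] at hmove
    rw [history_succ, history_succ]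
    exact hmove _ (history_succ p n ▸ isPlay_iff.1 hp (n + 1))

theorem hasDrawingStrategy_second_of_invariant (hk : k ≠ 0)
    (Good : Finset (Finset ℕ) → Finset (Finset ℕ) → Prop)
    (hstart : ∀ a : Finset ℕ, a.card = k → Good {a} ∅)
    (hsafe : ∀ A B, Disjoint A B → Good A B → HasCopy F A → HasCopy F B)
    (hstep : ∀ A B, Disjoint A B → Good A B → ForcesNext k Good A B) :
    HasDrawingStrategy F .second := by
  obtain ⟨s, hs⟩ := exists_strategy_second_of_invariant hk (fun A B => Disjoint A B ∧ Good A B)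
    (fun a ha => ⟨disjoint_empty_right _, hstart a ha⟩)
    fun A B h => (hstep A B h.1 h.2).disjoint h.1
  refine ⟨s, fun p hp hps hwins => ?_⟩
  obtain ⟨n, hn, hfirst, hsecond⟩ := hwins.exists_turn
  obtain ⟨hdisj, hgood⟩ := hs p hp hps (n + 1) (by rw [turn_succ, hn]; rfl)
  exact hsecond (hsafe _ _ hdisj hgood hfirst)

end Strategies

section Embeddings

variable {k : ℕ} {V : Type*} {F : KGraph k V} {f : V → ℕ} {A : Finset (Finset ℕ)}

theorem KGraph.image_injOn_edges {W : Type*} [DecidableEq W] (F : KGraph k V) {f : V → W}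
    (hf : Set.InjOn f F.verts) : Set.InjOn (image f) (F.edges : Set (Finset V)) :=
  (image_injOn_powerset_of_injOn hf).mono fun e he =>
    mem_coe.2 (mem_powerset.2 (F.edge_subset e he))

theorem EmbedsVia.card_image (h : EmbedsVia F f A) {e : Finset V} (he : e ∈ F.edges) :
    (e.image f).card = k := by
  rw [card_image_of_injOn (h.1.mono (coe_subset.2 (F.edge_subset e he))), F.uniform e he]

theorem EmbedsVia.card_le (h : EmbedsVia F f A) : F.edges.card ≤ A.card :=
  card_le_card_of_injOn (image f) h.2 (F.image_injOn_edges h.1)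

theorem EmbedsVia.image_edges_eq (h : EmbedsVia F f A) (hA : A.card ≤ F.edges.card) :
    F.edges.image (image f) = A :=
  eq_of_subset_of_card_le (image_subset_iff.2 h.2)
    (by rwa [card_image_of_injOn (F.image_injOn_edges h.1)])

theorem EmbedsVia.exists_image_eq_of_insert {t : Finset ℕ} (h : EmbedsVia F f (insert t A))
    (hA : ¬ HasCopy F A) : ∃ e ∈ F.edges, e.image f = t := by
  by_contra! hne
  exact hA ⟨f, h.1, fun e he => mem_of_mem_insert_of_ne (h.2 e he) (hne e he)⟩

variable [DecidableEq V]

theorem EmbedsVia.degree_le (h : EmbedsVia F f A) (v : V) :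
    F.degree v ≤ (A.filter (f v ∈ ·)).card := by
  refine card_le_card_of_injOn (image f) (fun e he => ?_)
    ((F.image_injOn_edges h.1).mono (filter_subset _ _))
  obtain ⟨heF, hve⟩ := mem_filter.1 he
  exact mem_filter.2 ⟨h.2 e heF, mem_image_of_mem f hve⟩

theorem card_filter_insert_le {α : Type*} [DecidableEq α] (s : Finset α) (a : α) (p : α → Prop)
    [DecidablePred p] : ((insert a s).filter p).card ≤ (s.filter p).card + 1 := by
  rw [filter_insert]
  split_ifs
  exacts [card_insert_le _ _, Nat.le_succ _]

end Embeddings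

section Rigid

variable {k : ℕ} {U V W : Type*} [DecidableEq V] [DecidableEq W] {H : KGraph k V}

/-- Monomorphisms into `H` from `H` with two edges deleted are identities. -/
def KGraph.IsRigid (H : KGraph k V) : Prop :=
  ∀ e ∈ H.edges, ∀ e' ∈ H.edges, e ≠ e' → ∀ φ : V → V,
    (H.deleteEdges {e, e'}).IsMonomorphism H φ → ∀ v ∈ (H.deleteEdges {e, e'}).verts, φ v = v

theorem KGraph.deleteEdges_verts_subset (H : KGraph k V) (S : Finset (Finset V)) :
    (H.deleteEdges S).verts ⊆ H.verts :=
  biUnion_subset.2 fun e he => H.edge_subset e (mem_sdiff.1 he).1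

theorem KGraph.mem_deleteEdges_verts {S : Finset (Finset V)} {v : V} (h : S.card < H.degree v) :
    v ∈ (H.deleteEdges S).verts := by
  obtain ⟨e, he, heS⟩ := exists_mem_notMem_of_card_lt_card h
  obtain ⟨heH, hve⟩ := mem_filter.1 he
  exact mem_biUnion.2 ⟨e, mem_sdiff.2 ⟨heH, heS⟩, hve⟩

theorem KGraph.isMonomorphism_invFunOn [Nonempty V] {F : KGraph k U} {θ : U → W} {ψ : V → W}
    (hθ : Set.InjOn θ F.verts) (hψ : Set.InjOn ψ H.verts)
    (hverts : ∀ u ∈ F.verts, θ u ∈ ψ '' H.verts)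
    (hedges : ∀ e ∈ F.edges, ∃ e' ∈ H.edges, e'.image ψ = e.image θ) :
    F.IsMonomorphism H (Function.invFunOn ψ H.verts ∘ θ) := by
  refine ⟨fun u hu => Function.invFunOn_mem (hverts u hu), fun u hu u' hu' huu' => ?_,
    fun e he => ?_⟩
  · apply hθ hu hu'
    rw [← Function.invFunOn_eq (hverts u hu), ← Function.invFunOn_eq (hverts u' hu')]
    exact congrArg ψ huu'
  · obtain ⟨e', he', h⟩ := hedges e he
    rw [← image_image, ← h, image_image]
    have hleft : Set.EqOn (Function.invFunOn ψ H.verts ∘ ψ) id e' := fun v hv =>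
      hψ.leftInvOn_invFunOn (H.edge_subset e' he' hv)
    rwa [image_congr hleft, image_id]

theorem KGraph.IsRigid.eqOn (hH : H.IsRigid) {θ ψ : V → W} (hθ : Set.InjOn θ H.verts)
    (hψ : Set.InjOn ψ H.verts) {e e' : Finset V} (he : e ∈ H.edges) (he' : e' ∈ H.edges)
    (hne : e ≠ e')
    (hedges : ∀ x ∈ H.edges, x ≠ e → x ≠ e' → ∃ y ∈ H.edges, y.image ψ = x.image θ) :
    Set.EqOn θ ψ (H.deleteEdges {e, e'}).verts := by
  intro v hv
  have : Nonempty V := ⟨v⟩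
  have hedges' : ∀ x ∈ (H.deleteEdges {e, e'}).edges, ∃ y ∈ H.edges, y.image ψ = x.image θ := by
    intro x hx
    simp only [KGraph.deleteEdges, mem_sdiff, mem_insert, mem_singleton, not_or] at hx
    exact hedges x hx.1 hx.2.1 hx.2.2
  have hverts : ∀ u ∈ (H.deleteEdges {e, e'}).verts, θ u ∈ ψ '' H.verts := by
    intro u hu
    obtain ⟨x, hx, hux⟩ := mem_biUnion.1 hu
    obtain ⟨y, hy, hyx⟩ := hedges' x hx
    obtain ⟨w, hw, hwu⟩ := mem_image.1 (hyx ▸ mem_image_of_mem θ hux)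
    exact ⟨w, H.edge_subset y hy hw, hwu⟩
  have hmono := isMonomorphism_invFunOn
    (hθ.mono (coe_subset.2 (H.deleteEdges_verts_subset _))) hψ hverts hedges'
  rw [← Function.invFunOn_eq (hverts v hv)]
  exact congrArg ψ (hH e he e' he' hne _ hmono v hv)

end Rigid

section Repin

variable {k : ℕ} {V : Type*} [DecidableEq V] {H : KGraph k V} {z : V} {w w' : ℕ}
  {ψ θ : V → ℕ} {x y : Finset V}

/-- The image of `x` under `f`, leaving out the pivot `z`. -/
def puncturedImage (z : V) (f : V → ℕ) (x : Finset V) : Finset ℕ :=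
  (x.erase z).image f

/-- The image of `x` under the map that sends the pivot `z` to `w` and agrees with `ψ` elsewhere. -/
def repin (z : V) (ψ : V → ℕ) (w : ℕ) (x : Finset V) : Finset ℕ :=
  x.image (Function.update ψ z w)

theorem puncturedImage_mono (h : x ⊆ y) : puncturedImage z ψ x ⊆ puncturedImage z ψ y :=
  image_subset_image (erase_subset_erase z h)

theorem mem_puncturedImage {v : V} (hv : v ∈ x) (hvz : v ≠ z) : ψ v ∈ puncturedImage z ψ x :=
  mem_image_of_mem ψ (mem_erase.2 ⟨hvz, hv⟩)

theorem puncturedImage_congr (h : Set.EqOn θ ψ (H.verts.erase z)) (hx : x ∈ H.edges) :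
    puncturedImage z θ x = puncturedImage z ψ x :=
  image_congr fun _ hv => h (erase_subset_erase z (H.edge_subset x hx) hv)

theorem apply_notMem_puncturedImage (hz : z ∈ H.verts) (hψ : Set.InjOn ψ H.verts) :
    ψ z ∉ puncturedImage z ψ H.verts := by
  intro h
  obtain ⟨v, hv, hvz⟩ := mem_image.1 h
  exact ne_of_mem_erase hv (hψ (mem_of_mem_erase hv) hz hvz)

theorem image_eq_insert_puncturedImage (hx : z ∈ x) :
    x.image ψ = insert (ψ z) (puncturedImage z ψ x) := by
  rw [puncturedImage, ← image_insert, insert_erase hx]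

theorem repin_apply_self : repin z ψ (ψ z) x = x.image ψ := by
  rw [repin, Function.update_eq_self]

theorem repin_of_notMem (hx : z ∉ x) : repin z ψ w x = x.image ψ :=
  image_congr fun _ hv => Function.update_of_ne (ne_of_mem_of_not_mem hv hx) _ _

theorem repin_of_mem (hx : z ∈ x) : repin z ψ w x = insert w (puncturedImage z ψ x) := by
  rw [repin, image_eq_insert_puncturedImage hx, Function.update_self, puncturedImage,
    puncturedImage]
  exact congrArg _ (repin_of_notMem (notMem_erase z x))

theorem mem_repin (hx : z ∈ x) : w ∈ repin z ψ w x := by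
  rw [repin_of_mem hx]
  exact mem_insert_self _ _

theorem image_eq_repin (h : Set.EqOn θ ψ (H.verts.erase z)) (hx : x ∈ H.edges) :
    x.image θ = repin z ψ (θ z) x := by
  by_cases hzx : z ∈ x
  · rw [image_eq_insert_puncturedImage hzx, repin_of_mem hzx, puncturedImage_congr h hx]
  · rw [repin_of_notMem hzx]
    simpa only [puncturedImage, erase_eq_of_notMem hzx] using puncturedImage_congr h hx

theorem eq_and_mem_of_mem_repin (hw : w ∉ puncturedImage z ψ H.verts) (hx : x ∈ H.edges)
    (h : w ∈ repin z ψ w' x) : w = w' ∧ z ∈ x := by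
  obtain ⟨v, hv, rfl⟩ := mem_image.1 h
  obtain rfl | hvz := eq_or_ne v z
  · exact ⟨Function.update_self .., hv⟩
  · rw [Function.update_of_ne hvz] at hw
    exact absurd (mem_puncturedImage (H.edge_subset x hx hv) hvz) hw

theorem injOn_update (hψ : Set.InjOn ψ (H.verts.erase z : Finset V))
    (hw : w ∉ puncturedImage z ψ H.verts) : Set.InjOn (Function.update ψ z w) H.verts := by
  have heq : Set.EqOn ψ (Function.update ψ z w) (H.verts.erase z : Finset V) := fun v hv =>
    (Function.update_of_ne (ne_of_mem_erase hv) _ _).symm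
  refine ((Set.injOn_insert (notMem_erase z H.verts)).2 ⟨hψ.congr heq, ?_⟩).mono
    fun v hv => ?_
  · rwa [Function.update_self, ← heq.image_eq, ← coe_image]
  · rw [← coe_insert]
    exact insert_erase_subset z H.verts hv

theorem repin_injOn (hψ : Set.InjOn ψ (H.verts.erase z : Finset V))
    (hw : w ∉ puncturedImage z ψ H.verts) : Set.InjOn (repin z ψ w) H.edges :=
  H.image_injOn_edges (injOn_update hψ hw)

theorem card_repin (hψ : Set.InjOn ψ (H.verts.erase z : Finset V))
    (hw : w ∉ puncturedImage z ψ H.verts) (hx : x ∈ H.edges) : (repin z ψ w x).card = k := by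
  rw [repin, card_image_of_injOn ((injOn_update hψ hw).mono (coe_subset.2 (H.edge_subset x hx))),
    H.uniform x hx]

theorem eq_and_eq_of_repin_eq (hψ : Set.InjOn ψ (H.verts.erase z : Finset V))
    (hw : w ∉ puncturedImage z ψ H.verts) (hx : x ∈ H.edges) (hy : y ∈ H.edges) (hzx : z ∈ x)
    (h : repin z ψ w x = repin z ψ w' y) : w = w' ∧ x = y := by
  obtain ⟨rfl, -⟩ := eq_and_mem_of_mem_repin hw hy (h ▸ mem_repin hzx)
  exact ⟨rfl, repin_injOn hψ hw hx hy h⟩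

theorem puncturedImage_eq_of_repin_eq (hψ : w ∉ puncturedImage z ψ H.verts)
    (hθ : w ∉ puncturedImage z θ H.verts) (hx : x ∈ H.edges) (hy : y ∈ H.edges) (hzx : z ∈ x)
    (hzy : z ∈ y) (h : repin z ψ w x = repin z θ w y) :
    puncturedImage z ψ x = puncturedImage z θ y := by
  rw [repin_of_mem hzx, repin_of_mem hzy] at h
  rw [← erase_insert fun hw => hψ (puncturedImage_mono (H.edge_subset x hx) hw), h,
    erase_insert fun hw => hθ (puncturedImage_mono (H.edge_subset y hy) hw)]

end Repin

section Pivot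

variable {k : ℕ} {V : Type*} [DecidableEq V] {H : KGraph k V} {z : V} {r g : Finset V}

/-- `r` and `g` are the two edges of `H` at the vertex `z`, which is the pivot of the copies of `H`
that a player builds from one copy of `H ∖ {z}`. -/
structure IsPivot (H : KGraph k V) (z : V) (r g : Finset V) : Prop where
  incidentEdges_eq : H.incidentEdges z = {r, g}
  ne : r ≠ g

/-- Conditions (i), (ii), (iv), (v) and (vi) of the theorem, all but the fast winning strategy. -/
structure IsAdmissible (H : KGraph k V) (z : V) (r g : Finset V) : Prop extends
    IsPivot H z r g where
  three_le_degree : ∀ u ∈ (H.deleteVertex z).verts, 3 ≤ (H.deleteVertex z).degree u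
  four_le_degree : ∀ u ∈ H.verts, u ≠ z → 4 ≤ H.degree u
  rigid : H.IsRigid
  meet : ∀ e ∈ H.edges, (e ∩ r).Nonempty ∧ (e ∩ g).Nonempty
  card_sdiff_lt : (H.verts \ (r ∪ g)).card < k - 1

theorem KGraph.mem_deleteVertex_edges {e : Finset V} :
    e ∈ (H.deleteVertex z).edges ↔ e ∈ H.edges ∧ z ∉ e :=
  mem_filter

namespace IsPivot

theorem symm (h : IsPivot H z r g) : IsPivot H z g r :=
  ⟨h.1.trans (pair_comm r g), h.2.symm⟩

theorem mem_edges_and_mem_iff (h : IsPivot H z r g) {e : Finset V} :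
    e ∈ H.edges ∧ z ∈ e ↔ e = r ∨ e = g := by
  have hmem : e ∈ H.incidentEdges z ↔ e ∈ H.edges ∧ z ∈ e := mem_filter
  rw [← hmem, h.incidentEdges_eq, mem_insert, mem_singleton]

theorem left_mem (h : IsPivot H z r g) : r ∈ H.edges :=
  (h.mem_edges_and_mem_iff.2 (.inl rfl)).1

theorem mem_left (h : IsPivot H z r g) : z ∈ r :=
  (h.mem_edges_and_mem_iff.2 (.inl rfl)).2

theorem right_mem (h : IsPivot H z r g) : g ∈ H.edges :=
  h.symm.left_mem

theorem mem_right (h : IsPivot H z r g) : z ∈ g :=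
  h.symm.mem_left

theorem mem_verts (h : IsPivot H z r g) : z ∈ H.verts :=
  H.edge_subset r h.left_mem h.mem_left

theorem eq_or_eq (h : IsPivot H z r g) {e : Finset V} (he : e ∈ H.edges) (hz : z ∈ e) :
    e = r ∨ e = g :=
  h.mem_edges_and_mem_iff.1 ⟨he, hz⟩

theorem card_edges_deleteVertex (h : IsPivot H z r g) :
    (H.deleteVertex z).edges.card + 2 = H.edges.card := by
  have hcard : (H.incidentEdges z).card = 2 := by rw [h.incidentEdges_eq, card_pair h.ne]
  rw [← card_filter_add_card_filter_not (s := H.edges) (z ∈ ·), add_comm, ← hcard]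
  rfl

theorem puncturedImage_ne (h : IsPivot H z r g) {f : V → ℕ}
    (hf : Set.InjOn f (H.verts.erase z : Finset V)) :
    puncturedImage z f r ≠ puncturedImage z f g := by
  intro heq
  obtain ⟨w, hw⟩ := Infinite.exists_notMem_finset (puncturedImage z f H.verts)
  refine h.ne (repin_injOn hf hw h.left_mem h.right_mem ?_)
  rw [repin_of_mem h.mem_left, repin_of_mem h.mem_right, heq]

end IsPivot

namespace IsAdmissible

variable {A : Finset (Finset ℕ)} {a c e t : Finset ℕ} {f χ χ' θ ψ : V → ℕ} {w : ℕ} {x : Finset V}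

theorem symm (hH : IsAdmissible H z r g) : IsAdmissible H z g r where
  toIsPivot := hH.toIsPivot.symm
  three_le_degree := hH.three_le_degree
  four_le_degree := hH.four_le_degree
  rigid := hH.rigid
  meet e he := (hH.meet e he).symm
  card_sdiff_lt := union_comm r g ▸ hH.card_sdiff_lt

theorem edges_deleteVertex_nonempty (hH : IsAdmissible H z r g) :
    (H.deleteVertex z).edges.Nonempty := by
  have hr : 1 < r.card := by
    have := hH.card_sdiff_lt
    have := H.uniform r hH.left_mem
    omega
  obtain ⟨v, hv, hvz⟩ := exists_mem_ne hr z
  have hdeg := hH.three_le_degree v (mem_erase.2 ⟨hvz, H.edge_subset r hH.left_mem hv⟩)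
  exact (card_pos.1 (by omega : 0 < (H.deleteVertex z).degree v)).mono (filter_subset _ _)

theorem eqOn_of_edges (hH : IsAdmissible H z r g) (hθ : Set.InjOn θ H.verts)
    (hψ : Set.InjOn ψ H.verts) {e e' : Finset V} (he : e ∈ H.edges) (he' : e' ∈ H.edges)
    (hne : e ≠ e')
    (hedges : ∀ x ∈ H.edges, x ≠ e → x ≠ e' → ∃ y ∈ H.edges, y.image ψ = x.image θ) :
    Set.EqOn θ ψ (H.verts.erase z) := by
  refine (hH.rigid.eqOn hθ hψ he he' hne hedges).mono fun v hv => KGraph.mem_deleteEdges_verts ?_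
  have hdeg := hH.four_le_degree v (mem_of_mem_erase hv) (ne_of_mem_erase hv)
  exact (card_le_two.trans_lt (by omega))

theorem eqOn_of_embedsVia (hH : IsAdmissible H z r g) (hθ : EmbedsVia H θ (insert t (insert a A)))
    (hψ : Set.InjOn ψ H.verts)
    (hedges : ∀ x ∈ H.edges, x.image θ ∈ A → ∃ y ∈ H.edges, y.image ψ = x.image θ) :
    Set.EqOn θ ψ (H.verts.erase z) := by
  have hnew : (H.edges.filter (image θ · ∉ A)).card ≤ 2 := by
    refine (card_le_card_of_injOn (t := {a, t}) (image θ) (fun x hx => ?_)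
      ((H.image_injOn_edges hθ.1).mono (filter_subset _ _))).trans card_le_two
    obtain ⟨hxH, hxA⟩ := mem_filter.1 hx
    have := hθ.2 x hxH
    simp only [mem_insert, hxA, or_false] at this
    simpa [or_comm] using this
  have htwo : 2 ≤ H.edges.card := by
    rw [← hH.card_edges_deleteVertex]
    exact Nat.le_add_left _ _
  obtain ⟨S, hnewS, hSH, hS⟩ := exists_subsuperset_card_eq (filter_subset _ _) hnew htwo
  obtain ⟨e, e', hne, rfl⟩ := card_eq_two.1 hS
  refine hH.eqOn_of_edges hθ.1 hψ (hSH (by simp)) (hSH (by simp)) hne fun x hx hxe hxe' =>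
    hedges x hx ?_
  by_contra hxA
  simpa [hxe, hxe'] using hnewS (mem_filter.2 ⟨hx, hxA⟩)

theorem eqOn_of_embedsVia_deleteVertex (hH : IsAdmissible H z r g)
    (hA : A.card ≤ (H.deleteVertex z).edges.card) (hχ : EmbedsVia (H.deleteVertex z) χ A)
    (hχ' : EmbedsVia (H.deleteVertex z) χ' A) : Set.EqOn χ χ' (H.verts.erase z) := by
  obtain ⟨w, hw⟩ := Infinite.exists_notMem_finset (puncturedImage z χ H.verts)
  obtain ⟨w', hw'⟩ := Infinite.exists_notMem_finset (puncturedImage z χ' H.verts)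
  have heq := hH.eqOn_of_edges (injOn_update hχ.1 hw) (injOn_update hχ'.1 hw') hH.left_mem
    hH.right_mem hH.ne fun x hx hxr hxg => ?_
  · intro v hv
    simpa only [Function.update_of_ne (ne_of_mem_erase hv)] using heq hv
  · have hzx : z ∉ x := fun hzx => (hH.eq_or_eq hx hzx).elim hxr hxg
    have hxA := hχ.2 x (KGraph.mem_deleteVertex_edges.2 ⟨hx, hzx⟩)
    rw [← hχ'.image_edges_eq hA] at hxA
    obtain ⟨y, hy, hyx⟩ := mem_image.1 hxA
    obtain ⟨hyH, hzy⟩ := KGraph.mem_deleteVertex_edges.1 hy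
    exact ⟨y, hyH, (repin_of_notMem hzy).trans (hyx.trans (repin_of_notMem hzx).symm)⟩

theorem apply_eq_of_mem_image (hH : IsAdmissible H z r g)
    (hθ : EmbedsVia H θ (insert t (insert a A))) (hw : (A.filter (w ∈ ·)).card ≤ 1)
    (hx : x ∈ H.edges) (hwx : w ∈ x.image θ) : θ z = w := by
  obtain ⟨v, hv, rfl⟩ := mem_image.1 hwx
  by_contra hne
  have hdeg := hH.four_le_degree v (H.edge_subset x hx hv) fun hvz => hne (hvz ▸ rfl)
  have := hθ.degree_le v
  have := card_filter_insert_le (insert a A) t (θ v ∈ ·)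
  have := card_filter_insert_le A a (θ v ∈ ·)
  omega

theorem two_le_card_filter (hH : IsAdmissible H z r g)
    (hχ : EmbedsVia (H.deleteVertex z) χ (insert a A)) {v : V} (hv : v ∈ H.verts.erase z) :
    2 ≤ (A.filter (χ v ∈ ·)).card := by
  have := hH.three_le_degree v hv
  have := hχ.degree_le v
  have := card_filter_insert_le A a (χ v ∈ ·)
  omega

end IsAdmissible

end Pivot

section Threats

variable {k : ℕ} {V : Type*} {H : KGraph k V} {A B : Finset (Finset ℕ)}

/-- The player holding `A` cannot complete a copy of `H` with one further edge outside `B`. -/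
def NoThreat (H : KGraph k V) (A B : Finset (Finset ℕ)) : Prop :=
  ∀ t ∉ B, ¬ HasCopy H (insert t A)

theorem NoThreat.not_hasCopy (h : NoThreat H A B) : ¬ HasCopy H A := by
  obtain ⟨t, ht⟩ := Infinite.exists_notMem_finset B
  exact fun hA => h t ht (hA.mono (subset_insert t A))

/-- The player holding `B` can complete a copy of `H` at once, and his opponent has none yet. -/
def CanFinish (H : KGraph k V) (A B : Finset (Finset ℕ)) : Prop :=
  ¬ HasCopy H A ∧ ∃ c, Unclaimed k A B c ∧ HasCopy H (insert c B)

end Threats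

section Pressing

variable {k : ℕ} {V : Type*} [DecidableEq V] {H : KGraph k V} {z : V} {r g : Finset V}
  {A B : Finset (Finset ℕ)} {c e t : Finset ℕ} {f χ θ : V → ℕ} {w : ℕ}

/-- Whenever the image of `g` at a new pivot of `f` fits one of the two pivot edges of a copy `χ`
of `H ∖ {z}` in `A`, the image of `r` at this pivot is the other one. -/
def SafeOrder (H : KGraph k V) (z : V) (r g : Finset V) (f : V → ℕ) (A : Finset (Finset ℕ)) :
    Prop :=
  ∀ χ, EmbedsVia (H.deleteVertex z) χ A →
    (puncturedImage z f g = puncturedImage z χ r → puncturedImage z f r = puncturedImage z χ g) ∧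
    (puncturedImage z f g = puncturedImage z χ g → puncturedImage z f r = puncturedImage z χ r)

/-- The player holding `B` may claim images of `r` at new pivots of the copy `f` of `H ∖ {z}`
forever: his opponent has no threat and does not gain one by the forced replies. -/
structure Pressing (H : KGraph k V) (z : V) (r g : Finset V) (f : V → ℕ)
    (A B : Finset (Finset ℕ)) : Prop where
  embedsVia : EmbedsVia (H.deleteVertex z) f B
  noThreat : NoThreat H A B
  safeOrder : SafeOrder H z r g f A

theorem exists_fresh_vertex (A : Finset (Finset ℕ)) (S : Finset ℕ) :
    ∃ w ∉ S, ∀ a ∈ A, w ∉ a := by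
  obtain ⟨w, hw⟩ := Infinite.exists_notMem_finset (S ∪ A.sup id)
  rw [notMem_union] at hw
  exact ⟨w, hw.1, fun a ha hwa => hw.2 (le_sup (f := id) ha hwa)⟩

theorem IsPivot.embedsVia_deleteVertex (hH : IsPivot H z r g)
    (hθ : EmbedsVia H θ (insert t (insert c A))) (ht : θ z ∈ t) (hc : θ z ∈ c) :
    EmbedsVia (H.deleteVertex z) θ A := by
  refine ⟨hθ.1.mono (coe_subset.2 (erase_subset _ _)), fun x hx => ?_⟩
  obtain ⟨hxH, hzx⟩ := KGraph.mem_deleteVertex_edges.1 hx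
  have hzx' : θ z ∉ x.image θ := fun h => by
    obtain ⟨v, hv, hvz⟩ := mem_image.1 h
    exact hzx (hθ.1 (H.edge_subset x hxH hv) hH.mem_verts hvz ▸ hv)
  exact mem_of_mem_insert_of_ne (mem_of_mem_insert_of_ne (hθ.2 x hxH)
    fun h => hzx' (h ▸ ht)) fun h => hzx' (h ▸ hc)

theorem IsPivot.image_eq_of_embedsVia (hH : IsPivot H z r g)
    (hθ : EmbedsVia H θ (insert t (insert c A))) (hA : ∀ a ∈ A, θ z ∉ a) :
    r.image θ = c ∧ g.image θ = t ∨ r.image θ = t ∧ g.image θ = c := by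
  have hmem : ∀ x ∈ H.edges, z ∈ x → x.image θ = t ∨ x.image θ = c := fun x hx hzx => by
    simpa only [mem_insert, or_assoc, or_iff_left fun h => hA _ h (mem_image_of_mem θ hzx)]
      using hθ.2 x hx
  have hne : r.image θ ≠ g.image θ := fun h =>
    hH.ne (H.image_injOn_edges hθ.1 hH.left_mem hH.right_mem h)
  have hr := hmem r hH.left_mem hH.mem_left
  have hg := hmem g hH.right_mem hH.mem_right
  grind

theorem IsPivot.embedsVia_update (hH : IsPivot H z r g) (hf : EmbedsVia (H.deleteVertex z) f B)
    (hw : w ∉ puncturedImage z f H.verts) :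
    EmbedsVia H (Function.update f z w) (insert (repin z f w g) (insert (repin z f w r) B)) := by
  refine ⟨injOn_update hf.1 hw, fun x hx => ?_⟩
  by_cases hzx : z ∈ x
  · obtain rfl | rfl := hH.eq_or_eq hx hzx
    exacts [mem_insert_of_mem (mem_insert_self _ _), mem_insert_self _ _]
  · have hxB := hf.2 x (KGraph.mem_deleteVertex_edges.2 ⟨hx, hzx⟩)
    rw [← repin_of_notMem hzx] at hxB
    exact mem_insert_of_mem (mem_insert_of_mem hxB)

theorem Pressing.noThreat_insert (hH : IsAdmissible H z r g) (h : Pressing H z r g f A B)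
    (hwA : ∀ a ∈ A, w ∉ a) (hwf : w ∉ puncturedImage z f H.verts) :
    NoThreat H (insert (repin z f w g) A) (insert (repin z f w r) B) := by
  rintro t ht ⟨θ, hθ⟩
  obtain ⟨htr, htB⟩ := not_or.1 (mem_insert.not.1 ht)
  obtain ⟨x, hx, hxg⟩ : ∃ x ∈ H.edges, x.image θ = repin z f w g := by
    rw [insert_comm] at hθ
    exact hθ.exists_image_eq_of_insert (h.noThreat t htB)
  have hwg : w ∈ repin z f w g := mem_repin hH.mem_right
  obtain rfl : θ z = w := hH.apply_eq_of_mem_image hθ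
    (by rw [filter_eq_empty_iff.2 fun a ha => hwA a ha]; exact Nat.zero_le _) hx (hxg ▸ hwg)
  have hθz := apply_notMem_puncturedImage hH.mem_verts hθ.1
  have hθA : θ z ∈ t → EmbedsVia (H.deleteVertex z) θ A := fun hzt =>
    hH.embedsVia_deleteVertex hθ hzt hwg
  have heq : ∀ x ∈ H.edges, z ∈ x → x.image θ = repin z f (θ z) g →
      puncturedImage z f g = puncturedImage z θ x := fun x hx hzx h =>
    puncturedImage_eq_of_repin_eq hwf hθz hH.right_mem hx hH.mem_right hzx
      (h.symm.trans repin_apply_self.symm)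
  obtain ⟨hr, rfl⟩ | ⟨rfl, hg⟩ := hH.image_eq_of_embedsVia hθ hwA
  · have hfr := (h.safeOrder θ (hθA (mem_image_of_mem θ hH.mem_right))).1
      (heq r hH.left_mem hH.mem_left hr)
    exact htr (by rw [image_eq_insert_puncturedImage hH.mem_right, repin_of_mem hH.mem_left, hfr])
  · have hfr := (h.safeOrder θ (hθA (mem_image_of_mem θ hH.mem_left))).2
      (heq g hH.right_mem hH.mem_right hg)
    exact htr (by rw [image_eq_insert_puncturedImage hH.mem_left, repin_of_mem hH.mem_left, hfr])

theorem SafeOrder.insert (hH : IsAdmissible H z r g) (h : SafeOrder H z r g f A)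
    (hwA : ∀ a ∈ A, w ∉ a) (hwc : w ∈ c) : SafeOrder H z r g f (insert c A) := by
  refine fun χ hχ => h χ ⟨hχ.1, fun x hx => mem_of_mem_insert_of_ne (hχ.2 x hx) ?_⟩
  rintro rfl
  obtain ⟨v, hv, rfl⟩ := mem_image.1 hwc
  have := hH.two_le_card_filter hχ ((H.deleteVertex z).edge_subset x hx hv)
  rw [filter_eq_empty_iff.2 fun a ha => hwA a ha] at this
  simp at this

theorem Pressing.forcesNext (hH : IsAdmissible H z r g) (h : Pressing H z r g f A B) :
    ForcesNext k (fun A B => CanFinish H A B ∨ Pressing H z r g f A B) A B := by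
  obtain ⟨w, hwf, hw⟩ := exists_fresh_vertex (A ∪ B) (puncturedImage z f H.verts)
  obtain ⟨hwA, hwB⟩ := forall_mem_union.1 hw
  have hunclaimed : ∀ x ∈ H.edges, z ∈ x → Unclaimed k A B (repin z f w x) := fun x hx hzx =>
    ⟨card_repin h.embedsVia.1 hwf hx, fun hA => hwA _ hA (mem_repin hzx),
      fun hB => hwB _ hB (mem_repin hzx)⟩
  have hr := hunclaimed r hH.left_mem hH.mem_left
  have hg := hunclaimed g hH.right_mem hH.mem_right
  have hne : repin z f w g ≠ repin z f w r := fun heq =>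
    hH.ne (repin_injOn h.embedsVia.1 hwf hH.right_mem hH.left_mem heq).symm
  refine ⟨repin z f w r, hr, fun b hb => ?_⟩
  obtain rfl | hbg := eq_or_ne b (repin z f w g)
  · exact .inr ⟨h.embedsVia.mono (subset_insert _ _), h.noThreat_insert hH hwA hwf,
      h.safeOrder.insert hH hwA (mem_repin hH.mem_right)⟩
  · refine .inl ⟨h.noThreat b fun hbB => hb.3 (mem_insert_of_mem hbB), repin z f w g,
      ⟨hg.1, ?_, ?_⟩, _, hH.embedsVia_update h.embedsVia hwf⟩
    · exact mem_insert.not.2 (not_or.2 ⟨hbg.symm, hg.2⟩)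
    · exact mem_insert.not.2 (not_or.2 ⟨hne, hg.3⟩)

end Pressing

section Blocked

variable {k : ℕ} {V : Type*} [DecidableEq V] {H : KGraph k V} {z : V} {r g : Finset V}
  {A B : Finset (Finset ℕ)} {a e t : Finset ℕ} {f χ θ ψ : V → ℕ} {w : ℕ}

/-- Every edge in `A` belongs to a copy of `H` that agrees with `ψ` off the pivot, and of the two
edges at the pivot of such a copy `B` contains one as soon as `A` contains the other. -/
structure IsPaired (H : KGraph k V) (z : V) (r g : Finset V) (ψ : V → ℕ)
    (A B : Finset (Finset ℕ)) : Prop where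
  injOn : Set.InjOn ψ (H.verts.erase z : Finset V)
  exists_repin_eq : ∀ a ∈ A, ∃ w ∉ puncturedImage z ψ H.verts, ∃ x ∈ H.edges, repin z ψ w x = a
  right_mem : ∀ w ∉ puncturedImage z ψ H.verts, repin z ψ w r ∈ A → repin z ψ w g ∈ B
  left_mem : ∀ w ∉ puncturedImage z ψ H.verts, repin z ψ w g ∈ A → repin z ψ w r ∈ B

/-- Every edge in `A` belongs to the copy `ψ` of `H`, of which `B` contains an edge that misses the
pivot. -/
structure IsCut (H : KGraph k V) (z : V) (ψ : V → ℕ) (A B : Finset (Finset ℕ)) : Prop where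
  injOn : Set.InjOn ψ H.verts
  exists_image_eq : ∀ a ∈ A, ∃ x ∈ H.edges, x.image ψ = a
  exists_image_mem : ∃ x ∈ H.edges, z ∉ x ∧ x.image ψ ∈ B

/-- The player holding `B` has answered every threat of the opponent, whose edges all come from
`ψ`. -/
inductive Blocked (H : KGraph k V) (z : V) (r g : Finset V) (ψ : V → ℕ)
    (A B : Finset (Finset ℕ)) : Prop
  | paired (h : IsPaired H z r g ψ A B)
  | cut (h : IsCut H z ψ A B)

namespace IsPaired

theorem symm (h : IsPaired H z r g ψ A B) : IsPaired H z g r ψ A B :=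
  ⟨h.1, h.2, h.4, h.3⟩

theorem card_filter_le_one (hH : IsPivot H z r g) (hAB : Disjoint A B)
    (h : IsPaired H z r g ψ A B) (hw : w ∉ puncturedImage z ψ H.verts) :
    (A.filter (w ∈ ·)).card ≤ 1 := by
  have hA : ∀ a ∈ A.filter (w ∈ ·), a ∈ A ∧ (a = repin z ψ w r ∨ a = repin z ψ w g) := by
    intro a ha
    obtain ⟨haA, hwa⟩ := mem_filter.1 ha
    obtain ⟨w', -, x, hx, rfl⟩ := h.exists_repin_eq a haA
    obtain ⟨rfl, hzx⟩ := eq_and_mem_of_mem_repin hw hx hwa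
    exact ⟨haA, (hH.eq_or_eq hx hzx).imp (congrArg _) (congrArg _)⟩
  have hnot : repin z ψ w r ∈ A → repin z ψ w g ∉ A := fun hr =>
    disjoint_right.1 hAB (h.right_mem w hw hr)
  refine card_le_one.2 fun a ha b hb => ?_
  obtain ⟨haA, rfl | rfl⟩ := hA a ha <;> obtain ⟨hbA, rfl | rfl⟩ := hA b hb
  exacts [rfl, absurd hbA (hnot haA), absurd haA (hnot hbA), rfl]

theorem eqOn (hH : IsAdmissible H z r g) (hAB : Disjoint A B) (h : IsPaired H z r g ψ A B)
    (hθ : EmbedsVia H θ (insert t (insert a A))) : Set.EqOn θ ψ (H.verts.erase z) := by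
  obtain ⟨w₀, hw₀, hθz⟩ :
      ∃ w₀ ∉ puncturedImage z ψ H.verts, θ z ∉ puncturedImage z ψ H.verts → w₀ = θ z := by
    by_cases hθz : θ z ∈ puncturedImage z ψ H.verts
    · obtain ⟨w₀, hw₀⟩ := Infinite.exists_notMem_finset (puncturedImage z ψ H.verts)
      exact ⟨w₀, hw₀, absurd hθz⟩
    · exact ⟨θ z, hθz, fun _ => rfl⟩
  have heq := hH.eqOn_of_embedsVia hθ (injOn_update h.injOn hw₀) fun x hx hxA => ?_
  · intro v hv
    simpa only [Function.update_of_ne (ne_of_mem_erase hv)] using heq hv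
  · obtain ⟨w, hw, y, hy, hyx⟩ := h.exists_repin_eq _ hxA
    refine ⟨y, hy, Eq.trans ?_ hyx⟩
    by_cases hzy : z ∈ y
    · have hwz : θ z = w := hH.apply_eq_of_mem_image hθ (h.card_filter_le_one hH.toIsPivot hAB hw)
        hx (hyx ▸ mem_repin hzy)
      rw [← hwz, ← hθz (hwz ▸ hw), repin]
    · exact (repin_of_notMem hzy).trans (repin_of_notMem hzy).symm

-- As `θ` agrees with `ψ` off the pivot, it puts both `r` and `g` outside `A`.
theorem eq_repin_of_hasCopy (hH : IsAdmissible H z r g) (hAB : Disjoint A B)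
    (h : IsPaired H z r g ψ A B) (haB : a ∉ B) (htB : t ∉ B)
    (hcopy : HasCopy H (insert t (insert a A))) :
    ∃ w ∉ puncturedImage z ψ H.verts, a = repin z ψ w r ∧ t = repin z ψ w g ∨
      a = repin z ψ w g ∧ t = repin z ψ w r := by
  obtain ⟨θ, hθ⟩ := hcopy
  have heq := h.eqOn hH hAB hθ
  have hw : θ z ∉ puncturedImage z ψ H.verts := by
    have := apply_notMem_puncturedImage hH.mem_verts hθ.1
    rwa [puncturedImage, image_congr heq] at this
  have hr := hθ.2 r hH.left_mem
  have hg := hθ.2 g hH.right_mem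
  rw [image_eq_repin heq hH.left_mem] at hr
  rw [image_eq_repin heq hH.right_mem] at hg
  have hne : repin z ψ (θ z) r ≠ repin z ψ (θ z) g := fun hrg =>
    hH.ne (repin_injOn h.injOn hw hH.left_mem hH.right_mem hrg)
  have hright := h.right_mem _ hw
  have hleft := h.left_mem _ hw
  have hdisj : ∀ c ∈ B, c ∉ A := fun _ hc => disjoint_right.1 hAB hc
  refine ⟨θ z, hw, ?_⟩
  simp only [mem_insert] at hr hg
  grind

theorem not_hasCopy_insert (hH : IsAdmissible H z r g) (hAB : Disjoint A B)
    (h : IsPaired H z r g ψ A B) (haB : a ∉ B) : ¬ HasCopy H (insert a A) := by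
  intro hcopy
  rw [← insert_idem] at hcopy
  obtain ⟨w, hw, ⟨hr, hg⟩ | ⟨hg, hr⟩⟩ := h.eq_repin_of_hasCopy hH hAB haB haB hcopy <;>
    exact hH.ne (repin_injOn h.injOn hw hH.left_mem hH.right_mem (hr.symm.trans hg))

theorem insert_repin (hH : IsPivot H z r g) (h : IsPaired H z r g ψ A B)
    (hw : w ∉ puncturedImage z ψ H.verts) :
    IsPaired H z r g ψ (insert (repin z ψ w r) A) (insert (repin z ψ w g) B) where
  injOn := h.injOn
  exists_repin_eq := forall_mem_insert _ _ _ |>.2 ⟨⟨w, hw, r, hH.left_mem, rfl⟩, h.exists_repin_eq⟩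
  right_mem w' hw' hr := by
    obtain heq | hr := mem_insert.1 hr
    · obtain ⟨rfl, -⟩ := eq_and_eq_of_repin_eq h.injOn hw' hH.left_mem hH.left_mem hH.mem_left heq
      exact mem_insert_self _ _
    · exact mem_insert_of_mem (h.right_mem w' hw' hr)
  left_mem w' hw' hg := by
    obtain heq | hg := mem_insert.1 hg
    · exact absurd (eq_and_eq_of_repin_eq h.injOn hw' hH.right_mem hH.left_mem hH.mem_right heq).2
        hH.ne.symm
    · exact mem_insert_of_mem (h.left_mem w' hw' hg)

end IsPaired

theorem IsCut.noThreat_insert (hH : IsAdmissible H z r g) (hAB : Disjoint A B)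
    (h : IsCut H z ψ A B) (haB : a ∉ B) : NoThreat H (insert a A) B := by
  rintro t htB ⟨θ, hθ⟩
  obtain ⟨x, hx, hzx, hxB⟩ := h.exists_image_mem
  have heq := hH.eqOn_of_embedsVia hθ h.injOn fun _ _ => h.exists_image_eq _
  have hxθ := hθ.2 x hx
  rw [image_eq_repin heq hx, repin_of_notMem hzx] at hxθ
  exact disjoint_right.1 hAB hxB (mem_of_mem_insert_of_ne (mem_of_mem_insert_of_ne hxθ
    (ne_of_mem_of_not_mem hxB htB)) (ne_of_mem_of_not_mem hxB haB))

theorem isPaired_of_image_notMem (hH : IsPivot H z r g) (hθ : Set.InjOn θ H.verts)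
    (hA : ∀ a ∈ A, ∃ x ∈ H.edges, x.image θ = a) {x : Finset V} (hx : x ∈ H.edges) (hzx : z ∈ x)
    (hxA : x.image θ ∉ A) : IsPaired H z r g θ A (insert (x.image θ) B) := by
  have hz := apply_notMem_puncturedImage hH.mem_verts hθ
  have hinj : Set.InjOn θ (H.verts.erase z : Finset V) :=
    hθ.mono (coe_subset.2 (erase_subset _ _))
  have hother : ∀ y y', y ∈ H.edges → z ∈ y → (x = y ∨ x = y') →
      ∀ w ∉ puncturedImage z θ H.verts, repin z θ w y ∈ A →
        repin z θ w y' ∈ insert (x.image θ) B := by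
    intro y y' hy hzy hxy w hw hyA
    obtain ⟨y₀, hy₀, hyy₀⟩ := hA _ hyA
    rw [← repin_apply_self (z := z)] at hyy₀
    obtain ⟨rfl, rfl⟩ := eq_and_eq_of_repin_eq hinj hw hy hy₀ hzy hyy₀.symm
    rw [repin_apply_self] at hyA ⊢
    obtain rfl | rfl := hxy
    exacts [absurd hyA hxA, mem_insert_self _ _]
  refine ⟨hinj, fun a ha => ?_, hother r g hH.left_mem hH.mem_left (hH.eq_or_eq hx hzx),
    hother g r hH.right_mem hH.mem_right (hH.symm.eq_or_eq hx hzx)⟩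
  obtain ⟨y, hy, rfl⟩ := hA a ha
  exact ⟨θ z, hz, y, hy, repin_apply_self⟩

theorem IsPivot.blocked_of_embedsVia (hH : IsPivot H z r g) (hA : A.card + 1 ≤ H.edges.card)
    (hθ : EmbedsVia H θ (insert t A)) : Blocked H z r g θ A (insert t B) := by
  have himage := hθ.image_edges_eq ((card_insert_le t A).trans hA)
  have hAθ : ∀ a ∈ A, ∃ x ∈ H.edges, x.image θ = a := fun a ha =>
    mem_image.1 (himage ▸ mem_insert_of_mem ha)
  obtain ⟨x, hx, rfl⟩ := mem_image.1 (himage ▸ mem_insert_self t A)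
  by_cases hzx : z ∈ x
  · refine .paired (isPaired_of_image_notMem hH hθ.1 hAθ hx hzx fun hxA => ?_)
    rw [insert_eq_of_mem hxA] at hθ
    have := hθ.card_le
    omega
  · exact .cut ⟨hθ.1, hAθ, x, hx, hzx, mem_insert_self _ _⟩

namespace Blocked

theorem noThreat_or_exists (hH : IsAdmissible H z r g) (hAB : Disjoint A B)
    (h : Blocked H z r g ψ A B) (haB : a ∉ B) :
    NoThreat H (insert a A) B ∨ ¬ HasCopy H (insert a A) ∧
      ∃ t, Unclaimed k (insert a A) B t ∧ Blocked H z r g ψ (insert a A) (insert t B) := by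
  obtain h | h := h
  · refine or_iff_not_imp_left.2 fun hthreat => ?_
    have hcopy := h.not_hasCopy_insert hH hAB haB
    obtain ⟨t, htB, ht⟩ : ∃ t ∉ B, HasCopy H (insert t (insert a A)) := by
      simpa only [NoThreat, not_forall, not_not, exists_prop] using hthreat
    have htA : t ∉ insert a A := fun htA => hcopy (insert_eq_of_mem htA ▸ ht)
    obtain ⟨w, hw, ⟨rfl, rfl⟩ | ⟨rfl, rfl⟩⟩ := h.eq_repin_of_hasCopy hH hAB haB htB ht
    · exact ⟨hcopy, _, ⟨card_repin h.injOn hw hH.right_mem, htA, htB⟩,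
        .paired (h.insert_repin hH.toIsPivot hw)⟩
    · exact ⟨hcopy, _, ⟨card_repin h.injOn hw hH.left_mem, htA, htB⟩,
        .paired (h.symm.insert_repin hH.symm.toIsPivot hw).symm⟩
  · exact .inl (h.noThreat_insert hH hAB haB)

theorem card_filter_le_one (hH : IsPivot H z r g) (hAB : Disjoint A B)
    (h : Blocked H z r g ψ A B) (hw : w ∉ H.verts.image ψ) : (A.filter (w ∈ ·)).card ≤ 1 := by
  obtain h | h := h
  · exact h.card_filter_le_one hH hAB fun hw' => hw (image_subset_image (erase_subset _ _) hw')
  · rw [filter_eq_empty_iff.2 fun a ha hwa => ?_]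
    · exact Nat.zero_le 1
    · obtain ⟨x, hx, rfl⟩ := h.exists_image_eq a ha
      exact hw (image_subset_image (H.edge_subset x hx) hwa)

theorem puncturedImage_subset (hH : IsAdmissible H z r g) (hAB : Disjoint A B)
    (h : Blocked H z r g ψ A B) (hχ : EmbedsVia (H.deleteVertex z) χ (insert a A)) :
    puncturedImage z χ H.verts ⊆ H.verts.image ψ := by
  refine image_subset_iff.2 fun v hv => ?_
  by_contra hvψ
  have := h.card_filter_le_one hH.toIsPivot hAB hvψ
  have := hH.two_le_card_filter hχ hv
  omega

end Blocked

theorem IsAdmissible.not_puncturedImage_subset (hH : IsAdmissible H z r g)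
    (hf : Set.InjOn f (H.verts.erase z : Finset V)) (hfe : ∀ v, f v ∉ e) (he : e.card = k)
    {S : Finset ℕ} (heS : e ⊆ S) (hS : S.card ≤ H.verts.card) :
    ¬ (puncturedImage z f r ⊆ S ∧ puncturedImage z f g ⊆ S) := by
  rintro ⟨hr, hg⟩
  have hrg : r ∪ g ⊆ H.verts :=
    union_subset (H.edge_subset r hH.left_mem) (H.edge_subset g hH.right_mem)
  have hunion : puncturedImage z f (r ∪ g) ⊆ S := by
    rw [puncturedImage, erase_union_distrib, image_union]
    exact union_subset hr hg
  have hdisj : Disjoint e (puncturedImage z f (r ∪ g)) :=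
    disjoint_right.2 fun _ hn => by
      obtain ⟨v, -, rfl⟩ := mem_image.1 hn
      exact hfe v
  have hle := card_le_card (union_subset heS hunion)
  rw [card_union_of_disjoint hdisj, puncturedImage,
    card_image_of_injOn (hf.mono (coe_subset.2 (erase_subset_erase z hrg))),
    card_erase_of_mem (mem_union_left g hH.mem_left)] at hle
  have := hH.card_sdiff_lt
  have := card_sdiff_add_card_eq_card hrg
  omega

theorem Blocked.safeOrder_or (hH : IsAdmissible H z r g) (hAB : Disjoint A B)
    (h : Blocked H z r g ψ A B) (he : e.card = k) (heψ : e ⊆ H.verts.image ψ)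
    (hf : Set.InjOn f (H.verts.erase z : Finset V)) (hfe : ∀ v, f v ∉ e) :
    SafeOrder H z r g f (insert a A) ∨ SafeOrder H z g r f (insert a A) := by
  have hsub : ∀ χ, EmbedsVia (H.deleteVertex z) χ (insert a A) → ∀ x ∈ H.edges,
      puncturedImage z χ x ⊆ H.verts.image ψ := fun χ hχ x hx =>
    (puncturedImage_mono (H.edge_subset x hx)).trans (h.puncturedImage_subset hH hAB hχ)
  have hvac : ∀ {y x χ}, ¬ puncturedImage z f y ⊆ H.verts.image ψ →
      EmbedsVia (H.deleteVertex z) χ (insert a A) → x ∈ H.edges →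
      puncturedImage z f y ≠ puncturedImage z χ x := fun hy hχ hx heq =>
    hy (heq ▸ hsub _ hχ _ hx)
  obtain hr | hg := not_and_or.1 (hH.not_puncturedImage_subset hf hfe he heψ card_image_le)
  · exact .inr fun χ hχ => ⟨fun heq => absurd heq (hvac hr hχ hH.right_mem),
      fun heq => absurd heq (hvac hr hχ hH.left_mem)⟩
  · exact .inl fun χ hχ => ⟨fun heq => absurd heq (hvac hg hχ hH.left_mem),
      fun heq => absurd heq (hvac hg hχ hH.right_mem)⟩

end Blocked

section Drawing

variable {k : ℕ} {V : Type*} [DecidableEq V] {H : KGraph k V} {z : V} {r g : Finset V}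
  {A B : Finset (Finset ℕ)} {a e t : Finset ℕ} {f χ ψ : V → ℕ}

theorem EmbedsVia.erase_of_puncturedImage_eq (hχ : EmbedsVia (H.deleteVertex z) χ A)
    (hfe : ∀ v, f v ∉ e) {x y : Finset V} (hmeet : ∀ x' ∈ H.edges, (x' ∩ x).Nonempty)
    (heq : puncturedImage z f y = puncturedImage z χ x) :
    EmbedsVia (H.deleteVertex z) χ (A.erase e) := by
  refine ⟨hχ.1, fun x' hx' => mem_erase.2 ⟨?_, hχ.2 x' hx'⟩⟩
  rintro rfl
  obtain ⟨hx'H, hzx'⟩ := KGraph.mem_deleteVertex_edges.1 hx'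
  obtain ⟨v, hv⟩ := hmeet x' hx'H
  obtain ⟨hve, hvx⟩ := mem_inter.1 hv
  have hχv := mem_puncturedImage (ψ := χ) hvx (ne_of_mem_of_not_mem hve hzx')
  obtain ⟨u, -, huv⟩ := mem_image.1 (heq ▸ hχv)
  exact hfe u (huv ▸ mem_image_of_mem χ hve)

-- Copies of `H ∖ {z}` in `A` that could spoil either order avoid `e`, and there is at most one.
theorem IsAdmissible.safeOrder_or_of_card_le (hH : IsAdmissible H z r g) (he : e ∈ A)
    (hA : A.card + 1 ≤ H.edges.card) (hf : Set.InjOn f (H.verts.erase z : Finset V))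
    (hfe : ∀ v, f v ∉ e) : SafeOrder H z r g f A ∨ SafeOrder H z g r f A := by
  have hcard : (A.erase e).card ≤ (H.deleteVertex z).edges.card := by
    have := hH.card_edges_deleteVertex
    rw [card_erase_of_mem he]
    omega
  have hunique : ∀ χ χ', EmbedsVia (H.deleteVertex z) χ (A.erase e) →
      EmbedsVia (H.deleteVertex z) χ' (A.erase e) → ∀ x ∈ H.edges,
        puncturedImage z χ x = puncturedImage z χ' x := fun χ χ' hχ hχ' x hx =>
    puncturedImage_congr (hH.eqOn_of_embedsVia_deleteVertex hcard hχ hχ') hx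
  have hr : ∀ χ y, EmbedsVia (H.deleteVertex z) χ A →
      puncturedImage z f y = puncturedImage z χ r → EmbedsVia (H.deleteVertex z) χ (A.erase e) :=
    fun χ y hχ => hχ.erase_of_puncturedImage_eq hfe fun x hx => (hH.meet x hx).1
  have hg : ∀ χ y, EmbedsVia (H.deleteVertex z) χ A →
      puncturedImage z f y = puncturedImage z χ g → EmbedsVia (H.deleteVertex z) χ (A.erase e) :=
    fun χ y hχ => hχ.erase_of_puncturedImage_eq hfe fun x hx => (hH.meet x hx).2
  have hne := hH.puncturedImage_ne hf
  by_contra! hspoiled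
  simp only [SafeOrder, not_forall, not_and_or] at hspoiled
  obtain ⟨⟨χ, hχ, hχg⟩, χ', hχ', hχr⟩ := hspoiled
  have := hunique χ χ'
  have := hH.left_mem
  have := hH.right_mem
  grind

/-- The positions `(A, B)` that the second player, holding `B` and on turn, maintains. He builds
`H ∖ {z}` away from the first edge `e` of his opponent, then parries threats by claiming `c`, then
presses, and completes `H` when he is not answered. -/
inductive DrawingPosition (H : KGraph k V) (z : V) (r g : Finset V) (A B : Finset (Finset ℕ)) : Prop
  | building (e : Finset ℕ) (he : e ∈ A) (hek : e.card = k)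
      (h : Forces k (fun A B => HasCopyAvoiding (H.deleteVertex z) e B ∧
        A.card ≤ (H.deleteVertex z).edges.card) A B)
  | threatened (e c : Finset ℕ) (ψ : V → ℕ) (hA : ¬ HasCopy H A) (hc : Unclaimed k A B c)
      (h : Blocked H z r g ψ A (insert c B)) (hek : e.card = k) (heψ : e ⊆ H.verts.image ψ)
      (hB : HasCopyAvoiding (H.deleteVertex z) e B)
  | pressing (f : V → ℕ) (h : Pressing H z r g f A B ∨ Pressing H z g r f A B)
  | finish (h : CanFinish H A B)
  | won (hB : HasCopy H B)

theorem drawingPosition_of_noThreat (hf : EmbedsVia (H.deleteVertex z) f B) (hA : NoThreat H A B)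
    (h : SafeOrder H z r g f A ∨ SafeOrder H z g r f A) : DrawingPosition H z r g A B :=
  .pressing f (h.imp (⟨hf, hA, ·⟩) (⟨hf, hA, ·⟩))

theorem Blocked.drawingPosition_insert (hH : IsAdmissible H z r g) (hAB : Disjoint A B)
    (h : Blocked H z r g ψ A B) (he : e.card = k) (heψ : e ⊆ H.verts.image ψ)
    (hB : HasCopyAvoiding (H.deleteVertex z) e B) (haB : a ∉ B) :
    DrawingPosition H z r g (insert a A) B := by
  obtain hthreat | ⟨hA, t, ht, hnext⟩ := h.noThreat_or_exists hH hAB haB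
  · obtain ⟨f, hf, hfe⟩ := hB
    exact drawingPosition_of_noThreat hf hthreat (h.safeOrder_or hH hAB he heψ hf.1 hfe)
  · exact .threatened e t ψ hA ht hnext he heψ hB

theorem IsAdmissible.drawingPosition_of_card_le (hH : IsAdmissible H z r g) (he : e ∈ A)
    (hek : e.card = k) (hA : A.card + 1 ≤ H.edges.card)
    (hB : HasCopyAvoiding (H.deleteVertex z) e B) :
    DrawingPosition H z r g A B := by
  have hcopy : ¬ HasCopy H A := fun ⟨_, hθ⟩ => absurd (hθ.card_le.trans_lt hA) (lt_irrefl _)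
  by_cases hthreat : NoThreat H A B
  · obtain ⟨f, hf, hfe⟩ := hB
    exact drawingPosition_of_noThreat hf hthreat (hH.safeOrder_or_of_card_le he hA hf.1 hfe)
  · obtain ⟨t, htB, θ, hθ⟩ : ∃ t ∉ B, HasCopy H (insert t A) := by
      simpa only [NoThreat, not_forall, not_not, exists_prop] using hthreat
    have htA : t ∉ A := fun htA => hcopy ⟨θ, insert_eq_of_mem htA ▸ hθ⟩
    obtain ⟨x, hx, rfl⟩ := hθ.exists_image_eq_of_insert hcopy
    have himage := hθ.image_edges_eq ((card_insert_le _ A).trans hA)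
    obtain ⟨y, hy, rfl⟩ := mem_image.1 (himage ▸ mem_insert_of_mem he)
    exact .threatened _ _ θ hcopy ⟨hθ.card_image hx, htA, htB⟩ (hH.blocked_of_embedsVia hA hθ) hek
      (image_subset_image (H.edge_subset y hy)) hB

theorem DrawingPosition.hasCopy_of_hasCopy (hH : IsAdmissible H z r g) (hk : k ≠ 0)
    (h : DrawingPosition H z r g A B) (hA : HasCopy H A) : HasCopy H B := by
  cases h with
  | building _ _ _ h =>
    obtain ⟨A', B', hAA', -, hcard⟩ := h.exists_superset hk
    obtain ⟨θ, hθ⟩ := hA.mono hAA'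
    have := hθ.card_le
    have := hH.card_edges_deleteVertex
    omega
  | threatened _ _ _ hA' => exact absurd hA hA'
  | pressing _ h => exact absurd hA (h.elim (·.noThreat.not_hasCopy) (·.noThreat.not_hasCopy))
  | finish h => exact absurd hA h.1
  | won hB => exact hB

theorem DrawingPosition.forcesNext (hH : IsAdmissible H z r g) (hk : k ≠ 0) (hAB : Disjoint A B)
    (h : DrawingPosition H z r g A B) : ForcesNext k (DrawingPosition H z r g) A B := by
  cases h with
  | building e he hek h =>
    cases h with
    | finish hc h =>
      refine ⟨_, hc, fun b hb => hH.drawingPosition_of_card_le (mem_insert_of_mem he) hek ?_ h.1⟩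
      rw [card_insert_of_notMem hb.2, ← hH.card_edges_deleteVertex]
      exact Nat.add_le_add_right h.2 2
    | move hc h => exact ⟨_, hc, fun b hb => .building e (mem_insert_of_mem he) hek (h b hb)⟩
  | threatened e c ψ _ hc h hek heψ hB =>
    have hdisj : Disjoint A (insert c B) := disjoint_insert_right.2 ⟨hc.2, hAB⟩
    exact ⟨c, hc, fun b hb => h.drawingPosition_insert hH hdisj hek heψ
      (hB.mono (subset_insert c B)) hb.3⟩
  | pressing f h =>
    obtain h | h := h
    · exact (h.forcesNext hH).imp fun A B h => h.elim .finish fun h => .pressing f (.inl h)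
    · exact (h.forcesNext hH.symm).imp fun A B h => h.elim .finish fun h => .pressing f (.inr h)
  | finish h =>
    obtain ⟨-, c, hc, hB⟩ := h
    exact ⟨c, hc, fun _ _ => .won hB⟩
  | won hB =>
    obtain ⟨c, hc⟩ := exists_unclaimed hk A B
    exact ⟨c, hc, fun _ _ => .won (hB.mono (subset_insert c B))⟩

theorem IsAdmissible.hasDrawingStrategy_second (hH : IsAdmissible H z r g)
    (hfast : HasFastWinningStrategy (H.deleteVertex z)) : HasDrawingStrategy H .second := by
  have hk : k ≠ 0 := fun hk => by
    have := hH.card_sdiff_lt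
    omega
  refine hasDrawingStrategy_second_of_invariant hk (DrawingPosition H z r g) (fun a ha => ?_)
    (fun A B _ h => h.hasCopy_of_hasCopy hH hk) fun A B hAB h => h.forcesNext hH hk hAB
  have hne : a.Nonempty := card_ne_zero.1 (ha ▸ hk)
  exact .building a (mem_singleton_self a) ha
    (hfast.forces_avoiding hk hH.edges_deleteVertex_nonempty hne)

end Drawing

end RamseyGame

theorem theorem2 {k : ℕ} {V : Type*} [DecidableEq V] (H : RamseyGame.KGraph k V)
    (z : V) (r g : Finset V)
    (hz : z ∈ H.verts) (hdeg : H.degree z = 2) (hrg : H.incidentEdges z = {r, g})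
    (hmin : ∀ u ∈ (H.deleteVertex z).verts, 3 ≤ (H.deleteVertex z).degree u)
    (hfour : ∀ u ∈ H.verts, u ≠ z → 4 ≤ H.degree u)
    (hfast : RamseyGame.HasFastWinningStrategy (H.deleteVertex z))
    (hrigid : ∀ e ∈ H.edges, ∀ e' ∈ H.edges, e ≠ e' → ∀ φ : V → V,
      (H.deleteEdges {e, e'}).IsMonomorphism H φ →
        ∀ v ∈ (H.deleteEdges {e, e'}).verts, φ v = v)
    (hmeet : ∀ e ∈ H.edges, (e ∩ r).Nonempty ∧ (e ∩ g).Nonempty)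
    (hsmall : (H.verts \ (r ∪ g)).card < k - 1) :
    RamseyGame.IsDraw H ∧ RamseyGame.HasDrawingStrategy H .second := by
  have hpivot : RamseyGame.IsPivot H z r g :=
    ⟨hrg, fun h => by simp [RamseyGame.KGraph.degree, hrg, h] at hdeg⟩
  have hdraw := (RamseyGame.IsAdmissible.mk hpivot hmin hfour hrigid hmeet
    hsmall).hasDrawingStrategy_second hfast
  exact ⟨fun
    | .first => RamseyGame.not_hasWinningStrategy_of_hasDrawingStrategy hdraw
    | .second => RamseyGame.not_hasWinningStrategy_second H, hdraw⟩
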